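/- **Setting.** Let $V=[n]$ with $n\ge 2$. A set function $\delta_h:2^h\to\mathbb R$ on a finite set $h$ is a *monotone submodular cut function* (MSCF) if $\delta_h(S)=\min\{F_h(S),F_h(h\setminus S)\}$ for all $S\subseteq h$, for some non-decreasing submodular $F_h:2^h\to\mathbb R$ with $F_h(\varnothing)=0$. An *MSCF-hypergraph* $G=(V,E,w,\mu)$ consists of a set $E$ of hyperedges $h\subseteq V$, weights $w\in\mathbb Z_{>0}^{E}$ and $\mu\in\mathbb Z_{\ge 0}^{V}$, and an MSCF $\delta_h$ for every $h\in E$. Write $\mu(S)=\sum_{i\in S}\mu_i$, $\delta_G(S)=\sum_{h\in E}w_h\,\delta_h(S\cap h)$, and $$\Psi_G(S)=\frac{\delta_G(S)}{\min\{\mu(S),\mu(V\setminus S)\}},$$ for $S$ with nonzero denominator. Such a set $A$ is a *$\kappa$-approximate minimum ratio-cut* if $\Psi_G(A)\le\kappa\,\Psi_G(S)$ for every such $S$. It is assumed that $\mu(V)>0$ and $\min_{i\in V}\mu_i/\mu(V)\ge n^{-k}$ for a fixed $k\in\mathbb N$. **Oracle.** A *seed* is a vector $s\in\mathbb R^V$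 with $\sum_i\mu_is_i=0$, $\|s\|_\infty\le 1$ and $\mu_is_i\neq 0$ for some $i$. The *ratio-cut improvement* objective is $\Psi_{G,s}(S)=\delta_G(S)/\big|\sum_{i\in S}\mu_is_i\big|$. For $0<\epsilon<1$, an *$\epsilon$-approximate primal-dual solution* for $(G,s)$ is a triple $(A,\alpha,Y)$ of a set $A\subseteq V$ with $\sum_{i\in A}\mu_is_i\ne0$, a number $\alpha\ge0$ and vectors $Y=(y_h\in\mathbb R^h)_{h\in E}$, with demands $\mathrm{dem}_i(Y)=\sum_{h\in E:\,h\ni i}(y_h)_i$, such that 1. $\sum_{i\in h}(y_h)_i=w_h\delta_h(h)=0$ and $\sum_{i\in S}(y_h)_i\le w_h\,\delta_h(S)$ for all $h\in E$ and $S\subseteq h$ (that is, $y_h$ lies in $w_h$ times the base polytope of $\delta_h$); 2. $\mathrm{dem}_i(Y)\,s_i\ge 0$ and $|\mathrm{dem}_i(Y)|\le\alpha\,\mu_i|s_i|$ for all $i\in V$; 3. $\sum_i|\alpha\mu_is_i-\mathrm{dem}_i(Y)|\le\epsilon\sum_i\alpha\mu_i|s_i|$; 4. $\Psi_{G,s}(A)\le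 2\alpha$. An *$\epsilon$-approximate primal-dual oracle* for $G$ answers every seed $s$ with an $\epsilon$-approximate primal-dual solution for $(G,s)$. An *oracle algorithm* is given $n$, the hyperedges of $G$ as vertex sets, $\mu$ and $\epsilon$; it adaptively calls the oracle on vectors $s$ and finally outputs a subset of $V$. It learns about the weights $w$ and the cut functions $\delta_h$ only through the oracle's replies. Only oracle calls are counted. **Statement.** For every $k\in\mathbb N$ there are a constant $C>0$ and a (deterministic) oracle algorithm such that, for all $n\ge2$, all $0<\epsilon<1$, every MSCF-hypergraph $G$ on $[n]$ with $\mu(V)>0$ and $\min_i\mu_i/\mu(V)\ge n^{-k}$, and every $\epsilon$-approximate primal-dual oracle for $G$, the algorithm outputs a $C\,\frac{\log n}{1-\epsilon}$-approximate minimum ratio-cut of $G$ and makes at most $C\,\frac{\log^2 n}{1-\epsilon}$ oracle calls. -/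

import Mathlib

/-- `δ` is a monotone submodular cut function (MSCF) on the hyperedge `h`: on subsets of `h` it is
`min (F S) (F (h \ S))` for a non-decreasing submodular `F : 2^h → ℝ` with `F ∅ = 0`.
(Only the values of `δ` and `F` at subsets of `h` matter.) -/
def IsMSCF {n : ℕ} (h : Finset (Fin n)) (δ : Finset (Fin n) → ℝ) : Prop :=
  ∃ F : Finset (Fin n) → ℝ,
    F ∅ = 0 ∧
    (∀ S T : Finset (Fin n), S ⊆ T → T ⊆ h → F S ≤ F T) ∧
    (∀ S T : Finset (Fin n), S ⊆ h → T ⊆ h → F (S ∪ T) ≤ F S + F T - F (S ∩ T)) ∧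
    ∀ S : Finset (Fin n), S ⊆ h → δ S = min (F S) (F (h \ S))

/-- A weighted hypergraph on the vertex set `[n]`, with positive integer hyperedge weights,
nonnegative integer vertex weights, and an MSCF on every hyperedge. The functions `w` and `δ`
are only used at hyperedges `h ∈ E`. -/
structure MSCFHypergraph (n : ℕ) where
  E : Finset (Finset (Fin n))
  w : Finset (Fin n) → ℕ
  w_pos : ∀ h ∈ E, 0 < w h
  μ : Fin n → ℕ
  δ : Finset (Fin n) → Finset (Fin n) → ℝ
  mscf : ∀ h ∈ E, IsMSCF h (δ h)

/-- A hypergraph flow assigns a real number `Y h i` to every hyperedge `h` and every `i ∈ h`;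
the values at `h ∉ E` or `i ∉ h` are never used. -/
abbrev HypergraphFlow (n : ℕ) : Type := Finset (Fin n) → Fin n → ℝ

namespace MSCFHypergraph

variable {n : ℕ}

/-- `μ(S) = ∑_{i ∈ S} μ_i`. -/
def vol (G : MSCFHypergraph n) (S : Finset (Fin n)) : ℝ := ∑ i ∈ S, (G.μ i : ℝ)

/-- `δ_G(S) = ∑_{h ∈ E} w_h δ_h(S ∩ h)`. -/
def cut (G : MSCFHypergraph n) (S : Finset (Fin n)) : ℝ :=
  ∑ h ∈ G.E, (G.w h : ℝ) * G.δ h (S ∩ h)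

/-- The ratio-cut objective `Ψ_G(S) = δ_G(S) / min {μ(S), μ(V \ S)}`. -/
noncomputable def ratioCut (G : MSCFHypergraph n) (S : Finset (Fin n)) : ℝ :=
  G.cut S / min (G.vol S) (G.vol Sᶜ)

/-- `S` is a cut at which the ratio-cut objective is defined (nonzero denominator). -/
def IsCut (G : MSCFHypergraph n) (S : Finset (Fin n)) : Prop :=
  0 < min (G.vol S) (G.vol Sᶜ)

/-- `A` is a `κ`-approximate minimum ratio-cut: `Ψ_G(A) ≤ κ · min_S Ψ_G(S)`. -/
def IsApproxMinRatioCut (G : MSCFHypergraph n) (κ : ℝ) (A : Finset (Fin n)) : Prop :=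
  G.IsCut A ∧ ∀ S : Finset (Fin n), G.IsCut S → G.ratioCut A ≤ κ * G.ratioCut S

/-- `min_i μ_i / μ(V) ≥ 1 / n ^ k`. -/
def PolyBounded (G : MSCFHypergraph n) (k : ℕ) : Prop :=
  0 < G.vol Finset.univ ∧
    ∀ i : Fin n, 1 / (n : ℝ) ^ k ≤ (G.μ i : ℝ) / G.vol Finset.univ

/-- A (nontrivial) seed: `⟨s, 1⟩_μ = 0`, `‖s‖_∞ ≤ 1`, and `s` does not vanish `μ`-everywhere
(otherwise the ratio-cut improvement objective is nowhere defined). -/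
def IsSeed (G : MSCFHypergraph n) (s : Fin n → ℝ) : Prop :=
  ∑ i, (G.μ i : ℝ) * s i = 0 ∧ (∀ i, |s i| ≤ 1) ∧ ∃ i, (G.μ i : ℝ) * s i ≠ 0

/-- `⟨s, 1_S⟩_μ = ∑_{i ∈ S} μ_i s_i`. -/
def corr (G : MSCFHypergraph n) (s : Fin n → ℝ) (S : Finset (Fin n)) : ℝ :=
  ∑ i ∈ S, (G.μ i : ℝ) * s i

/-- The ratio-cut improvement objective `Ψ_{G,s}(S) = δ_G(S) / |∑_{i ∈ S} μ_i s_i|`. -/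
noncomputable def improvement (G : MSCFHypergraph n) (s : Fin n → ℝ) (S : Finset (Fin n)) : ℝ :=
  G.cut S / |G.corr s S|

/-- The demand vector `dem_i(Y) = ∑_{h ∈ E, i ∈ h} (y_h)_i`. -/
def dem (G : MSCFHypergraph n) (Y : HypergraphFlow n) (i : Fin n) : ℝ :=
  ∑ h ∈ G.E with i ∈ h, Y h i

/-- `y_h ∈ w_h · B(δ_h)` for every hyperedge `h`, where
`B(δ_h) = {y ∈ ℝ^h : y(h) = δ_h(h) = 0, y(S) ≤ δ_h(S) for all S ⊆ h}` is the base polytope. -/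
def IsFeasibleFlow (G : MSCFHypergraph n) (Y : HypergraphFlow n) : Prop :=
  ∀ h ∈ G.E, ∑ i ∈ h, Y h i = (G.w h : ℝ) * G.δ h h ∧
    ∀ S : Finset (Fin n), S ⊆ h → ∑ i ∈ S, Y h i ≤ (G.w h : ℝ) * G.δ h S

end MSCFHypergraph

/-- A reply of a primal-dual solver: a primal solution (the set `A`) and
a dual solution (the value `α` and the hypergraph flow `Y`). -/
structure PrimalDualReply (n : ℕ) where
  A : Finset (Fin n)
  α : ℝ
  Y : HypergraphFlow n

/-- `r = (A, α, Y)` is an `ε`-approximate primal-dual solution of the ratio-cut improvement problem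
`min_S Ψ_{G,s}(S)`, whose dual is
`max {α : dem(Y) = α (μ ∘ s), y_h ∈ w_h · B(δ_h) for all h}`:
* the flow is feasible;
* `dem(Y)` is coordinatewise between `0` and `α (μ ∘ s)`;
* `‖α (μ ∘ s) - dem(Y)‖₁ ≤ ε ‖α (μ ∘ s)‖₁`;
* the objective is defined at `A`, and `Ψ_{G,s}(A) ≤ 2 α`. -/
def IsApproxPrimalDual {n : ℕ} (G : MSCFHypergraph n) (ε : ℝ) (s : Fin n → ℝ)
    (r : PrimalDualReply n) : Prop :=
  0 ≤ r.α ∧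
  G.IsFeasibleFlow r.Y ∧
  (∀ i, 0 ≤ G.dem r.Y i * s i ∧ |G.dem r.Y i| ≤ r.α * ((G.μ i : ℝ) * |s i|)) ∧
  ∑ i, |r.α * ((G.μ i : ℝ) * s i) - G.dem r.Y i| ≤ ε * ∑ i, |r.α * ((G.μ i : ℝ) * s i)| ∧
  G.corr s r.A ≠ 0 ∧
  G.improvement s r.A ≤ 2 * r.α

/-- `O` is an `ε`-approximate primal-dual oracle for ratio-cut improvement on `G`: it answers every
seed with an `ε`-approximate primal-dual solution. -/
def IsApproxOracle {n : ℕ} (G : MSCFHypergraph n) (ε : ℝ)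
    (O : (Fin n → ℝ) → PrimalDualReply n) : Prop :=
  ∀ s : Fin n → ℝ, G.IsSeed s → IsApproxPrimalDual G ε s (O s)

/-- An adaptive procedure that interacts with an oracle: it either stops and outputs a set, or
calls the oracle on some `s` and continues depending on the reply. -/
inductive OracleProcedure (n : ℕ) : Type where
  | output (A : Finset (Fin n)) : OracleProcedure n
  | call (s : Fin n → ℝ) (next : PrimalDualReply n → OracleProcedure n) : OracleProcedure n

namespace OracleProcedure

variable {n : ℕ}

/-- The set output by the procedure when it is run with the oracle `O`. -/
def result (O : (Fin n → ℝ) → PrimalDualReply n) : OracleProcedure n → Finset (Fin n)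
  | output A => A
  | call s next => result O (next (O s))

/-- The number of oracle calls made by the procedure when it is run with the oracle `O`. -/
def calls (O : (Fin n → ℝ) → PrimalDualReply n) : OracleProcedure n → ℕ
  | output _ => 0
  | call s next => calls O (next (O s)) + 1

end OracleProcedure

/-- An oracle algorithm for minimum ratio-cut. It reads the number `n` of vertices, the hyperedges
(as vertex sets), the vertex weights and `ε`. The hyperedge weights `w` and the cut functions `δ`
are not given to it: it has access to them only through the replies of the oracle (an algorithm
that reads all of the hypergraph, and has no bound on its other work, would need no oracle). -/
abbrev RatioCutAlgorithm : Type :=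
  (n : ℕ) → (E : Finset (Finset (Fin n))) → (μ : Fin n → ℕ) → (ε : ℝ) → OracleProcedure n

/-! The proof is a cut-matching game with an entropy potential. A seed has mean zero and sup norm at
most 1, so every reply contains a cut of ratio at most `2 * α`; its flow, in turn, bounds all cuts
from below. Let `a` be the least `α` seen and `A` its cut. Lower bounds are collected in a function
`B`: one call may raise `B S` by at most `G.cut S / α`. Once `B S` is at least 1/64 of the mass of
`S` for every `S` no heavier than its complement, after at most `T` counted calls, `A` is a `128 *
T`-approximation (`Certified.isApprox`). It remains to get there with `T` of order `log n / (1 -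
ε)`.

In the mixing phase `B S` is the mass that a measure-preserving transport `P`, initially the
identity, moves out of `S`. While some balanced `S` has small `B S`, a seed separates vertices of
`S` and of its complement whose rows of `P` are far apart (`exists_mixing_seed`). The flow becomes a
symmetric graph with the absolute demands as degrees (`exists_matching_of_hypergraphFlow`). Its cuts
are at most twice those of `G`, because `F_h` is monotone (`IsMSCF.min_sum_abs_le`). A lazy random
walk step along this graph averages distant rows and raises the entropy by `(1 - ε) / 64` of the
total mass (`transportEntropy_mixStep_ge`). The entropy is at most `log n` times the total mass,
which bounds the number of steps.

When no balanced sparse set is left, let `U` be a heaviest sparse set of at most half the mass. Each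
further call routes all but a fraction `ε` of the supply still left in `U` out of `U`. As the vertex
weights are polynomially bounded, about `k * log n / (1 - ε)` calls make every vertex of `U` send
half its weight. Now every smaller side `S` is either expanded by `P` or lies mostly in `U` and
sends out routed demand (`le_max_transportCut`).

The procedure may not see `w` and `δ`. In `Solvable` it is therefore chosen before the hypergraph,
for the whole class of hypergraphs consistent with the replies so far. -/

section CutMatching

open Finset

/-! ### Flows and their shortcutting -/

/-- Rerouting a flow along shortcuts: there is a flow with the same net supplies and no larger cuts
in which no vertex has both an incoming and an outgoing arc. -/
theorem exists_flow_without_two_paths {V : Type*} [Fintype V] [DecidableEq V]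
    (D₀ : V → V → ℝ) (h₀ : ∀ i j, 0 ≤ D₀ i j) :
    ∃ D : V → V → ℝ, (∀ i j, 0 ≤ D i j) ∧
      (∀ f : V → ℝ, ∑ x, ∑ y, (f x - f y) * D x y = ∑ x, ∑ y, (f x - f y) * D₀ x y) ∧
      (∀ S : Finset V, ∑ x, ∑ y, (if x ∈ S ↔ y ∈ S then 0 else 1) * D x y
        ≤ ∑ x, ∑ y, (if x ∈ S ↔ y ∈ S then 0 else 1) * D₀ x y) ∧
      ∀ i v j, D i v = 0 ∨ D v j = 0 := by
  set C : ℝ := ∑ x, ∑ y, D₀ x y with hC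
  -- The net supplies are encoded weakly, by testing against all potentials `f`; the bound `C` on
  -- the total mass makes the set compact.
  let K : Set (V → V → ℝ) := Set.Icc 0 (fun _ _ => C) ∩ ({D | ∑ x, ∑ y, D x y ≤ C} ∩
    ({D | ∀ f : V → ℝ, ∑ x, ∑ y, (f x - f y) * D x y = ∑ x, ∑ y, (f x - f y) * D₀ x y} ∩
     {D | ∀ S : Finset V, ∑ x, ∑ y, (if x ∈ S ↔ y ∈ S then 0 else 1) * D x y
        ≤ ∑ x, ∑ y, (if x ∈ S ↔ y ∈ S then 0 else 1) * D₀ x y}))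
  have entry_le : ∀ D : V → V → ℝ, (∀ i j, 0 ≤ D i j) → ∀ i j, D i j ≤ ∑ x, ∑ y, D x y := by
    intro D hD i j
    calc D i j ≤ ∑ y, D i y := single_le_sum (f := fun y => D i y) (fun y _ => hD i y) (mem_univ j)
      _ ≤ ∑ x, ∑ y, D x y := single_le_sum (f := fun x => ∑ y, D x y)
          (fun x _ => sum_nonneg fun y _ => hD x y) (mem_univ i)
  have hK : IsCompact K := by
    refine isCompact_Icc.inter_right (IsClosed.inter ?_ (IsClosed.inter ?_ ?_))
    · exact isClosed_le (by fun_prop) continuous_const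
    · simp only [Set.ofPred_forall]
      exact isClosed_iInter fun f => isClosed_eq (by fun_prop) continuous_const
    · simp only [Set.ofPred_forall]
      exact isClosed_iInter fun S => isClosed_le (by fun_prop) continuous_const
  have hne : K.Nonempty :=
    ⟨D₀, ⟨fun i j => h₀ i j, fun i j => entry_le D₀ h₀ i j⟩, le_refl C, fun _ => rfl, fun _ => le_rfl⟩
  obtain ⟨D, ⟨⟨hD0, -⟩, hDC, hDnet, hDcut⟩, hmin⟩ :=
    hK.exists_isMinOn hne (f := fun D : V → V → ℝ => ∑ x, ∑ y, D x y) (by fun_prop)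
  refine ⟨D, fun i j => hD0 i j, hDnet, hDcut, fun i v j => ?_⟩
  by_contra hcon
  push Not at hcon
  have p1 : 0 < D i v := lt_of_le_of_ne (hD0 i v) (Ne.symm hcon.1)
  have p2 : 0 < D v j := lt_of_le_of_ne (hD0 v j) (Ne.symm hcon.2)
  set t := min (D i v) (D v j) with ht
  have t0 : 0 < t := lt_min p1 p2
  have t1 : t ≤ D i v := min_le_left _ _
  have t2 : t ≤ D v j := min_le_right _ _
  -- Move `t` units from the path `i → v → j` to the arc `i → j`. Coincidences among `i`, `v`, `j`
  -- are allowed, so loops are excluded too. The total mass drops by `t`, contradicting minimality.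
  let D' : V → V → ℝ := fun x y => D x y + t * ((if x = i then if y = j then 1 else 0 else 0)
    - (if x = i then if y = v then 1 else 0 else 0) - (if x = v then if y = j then 1 else 0 else 0))
  have lin : ∀ φ : V → V → ℝ, ∑ x, ∑ y, φ x y * D' x y
      = ∑ x, ∑ y, φ x y * D x y + t * (φ i j - φ i v - φ v j) := by
    intro φ
    have : ∀ x y, φ x y * D' x y = φ x y * D x y + (t * (if x = i then if y = j then φ x y else 0 else 0)
      - t * (if x = i then if y = v then φ x y else 0 else 0)
      - t * (if x = v then if y = j then φ x y else 0 else 0)) := by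
      intro x y
      simp only [D']
      split_ifs <;> ring
    simp only [this, sum_add_distrib, sum_sub_distrib, ← mul_sum]
    have e : ∀ a b : V, ∑ x, ∑ y, (if x = a then if y = b then φ x y else 0 else 0) = φ a b := by
      intro a b
      rw [sum_eq_single a (by intro c _ hc; simp [hc]) (by simp)]
      simp
    rw [e, e, e]
    ring
  have tot : ∑ x, ∑ y, D' x y = ∑ x, ∑ y, D x y - t := by
    have := lin (fun _ _ => 1)
    simp only [one_mul] at this
    rw [this]; ring
  have hD'0 : ∀ x y, 0 ≤ D' x y := by
    intro x y
    have := hD0 x y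
    simp only [Pi.zero_apply] at this
    simp only [D']
    have b1 : x = i → y = v → t ≤ D x y := fun h h' => by rw [h, h']; exact t1
    have b2 : x = v → y = j → t ≤ D x y := fun h h' => by rw [h, h']; exact t2
    split_ifs with h1 h2 h3 h4 h5 h6 h7 <;> first
      | linarith [b1 ‹_› ‹_›]
      | linarith [b2 ‹_› ‹_›]
      | linarith
  have hmem : D' ∈ K := by
    have hle : ∑ x, ∑ y, D' x y ≤ C := by rw [tot]; linarith [show ∑ x, ∑ y, D x y ≤ C from hDC]
    refine ⟨⟨fun x y => hD'0 x y, fun x y => (entry_le D' hD'0 x y).trans hle⟩, hle, fun f => ?_,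
      fun S => ?_⟩
    · rw [lin, hDnet f]; ring
    · rw [lin]
      refine le_trans ?_ (hDcut S)
      -- Triangle inequality for the cut pseudometric of `S`.
      have : (if i ∈ S ↔ j ∈ S then (0 : ℝ) else 1) - (if i ∈ S ↔ v ∈ S then 0 else 1)
          - (if v ∈ S ↔ j ∈ S then 0 else 1) ≤ 0 := by
        by_cases a : i ∈ S <;> by_cases b : j ∈ S <;> by_cases c : v ∈ S <;> simp [a, b, c]
      nlinarith
  have := hmin hmem
  simp only [Set.mem_ofPred_eq] at this
  rw [tot] at this
  linarith

/-- A flow can be replaced by a symmetric weighted graph joining sources to sinks whose degrees are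
the net supplies and whose cuts are no larger. -/
theorem exists_symm_matching {V : Type*} [Fintype V] [DecidableEq V]
    (D₀ : V → V → ℝ) (h₀ : ∀ i j, 0 ≤ D₀ i j) (d : V → ℝ)
    (hd : ∀ f : V → ℝ, ∑ x, ∑ y, (f x - f y) * D₀ x y = ∑ x, f x * d x) :
    ∃ M : V → V → ℝ, (∀ i j, 0 ≤ M i j) ∧ (∀ i j, M i j = M j i) ∧ (∀ i, ∑ j, M i j = |d i|) ∧
      (∀ i j, M i j ≠ 0 → d i * d j < 0) ∧
      ∀ S : Finset V, ∑ i ∈ S, ∑ j ∈ Sᶜ, M i j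
        ≤ ∑ x, ∑ y, (if x ∈ S ↔ y ∈ S then 0 else 1) * D₀ x y := by
  obtain ⟨D, hD0, hnet, hcut, hpath⟩ := exists_flow_without_two_paths D₀ h₀
  have net : ∀ u, ∑ y, D u y - ∑ y, D y u = d u := by
    intro u
    have h := (hnet (fun x => if x = u then 1 else 0)).trans (hd _)
    simp only [sub_mul, sum_sub_distrib, ite_mul, one_mul, zero_mul, sum_ite_eq', mem_univ,
      if_true] at h
    rw [← h]
    congr 1
    rw [sum_comm]
    simp
  have out_or_in : ∀ u, (∑ y, D y u = 0) ∨ (∑ y, D u y = 0) := by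
    intro u
    by_cases h : ∃ i, D i u ≠ 0
    · obtain ⟨i, hi⟩ := h
      exact Or.inr (sum_eq_zero fun j _ => (hpath i u j).resolve_left hi)
    · push Not at h
      exact Or.inl (sum_eq_zero fun j _ => h j)
  have hin : ∀ u, 0 ≤ ∑ y, D y u := fun u => sum_nonneg fun y _ => hD0 y u
  have hout : ∀ u, 0 ≤ ∑ y, D u y := fun u => sum_nonneg fun y _ => hD0 u y
  have opp : ∀ i j, D i j ≠ 0 → 0 < d i ∧ d j < 0 := by
    intro i j hij
    have hpos : 0 < D i j := lt_of_le_of_ne (hD0 i j) (Ne.symm hij)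
    have h1 : D i j ≤ ∑ y, D i y :=
      single_le_sum (f := fun y => D i y) (fun y _ => hD0 i y) (mem_univ j)
    have h2 : D i j ≤ ∑ x, D x j :=
      single_le_sum (f := fun x => D x j) (fun x _ => hD0 x j) (mem_univ i)
    have n1 := net i
    have n2 := net j
    rcases out_or_in i with a | a <;> rcases out_or_in j with b | b <;> constructor <;> linarith
  -- Without two-arc paths each vertex is a pure source or a pure sink, so out-flow plus in-flow is
  -- the absolute net supply.
  refine ⟨fun i j => D i j + D j i, fun i j => add_nonneg (hD0 i j) (hD0 j i),
    fun i j => add_comm _ _, fun i => ?_, fun i j hij => ?_, fun S => ?_⟩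
  · rw [sum_add_distrib]
    have := net i
    rcases out_or_in i with a | a
    · rw [abs_of_nonneg (by linarith [hout i])]; linarith
    · rw [abs_of_nonpos (by linarith [hin i])]; linarith
  · by_cases h : D i j = 0
    · have h' : D j i ≠ 0 := by intro h'; simp [h, h'] at hij
      obtain ⟨a, b⟩ := opp j i h'
      exact mul_neg_of_neg_of_pos b a
    · obtain ⟨a, b⟩ := opp i j h
      exact mul_neg_of_pos_of_neg a b
  · refine le_of_eq_of_le ?_ (hcut S)
    have e : ∀ x y, (if x ∈ S ↔ y ∈ S then (0 : ℝ) else 1) * D x y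
        = (if x ∈ S then if y ∈ Sᶜ then D x y else 0 else 0)
          + (if y ∈ S then if x ∈ Sᶜ then D x y else 0 else 0) := by
      intro x y
      by_cases a : x ∈ S <;> by_cases b : y ∈ S <;> simp [a, b]
    simp only [e, sum_add_distrib]
    have e' : ∀ F : V → V → ℝ, ∑ x, ∑ y, (if x ∈ S then if y ∈ Sᶜ then F x y else 0 else 0)
        = ∑ x ∈ S, ∑ y ∈ Sᶜ, F x y := by
      intro F
      have : ∀ x, ∑ y, (if x ∈ S then if y ∈ Sᶜ then F x y else 0 else 0)
          = if x ∈ S then ∑ y ∈ Sᶜ, F x y else 0 := by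
        intro x
        split_ifs
        · rw [sum_ite_mem, univ_inter]
        · exact sum_const_zero
      simp only [this, sum_ite_mem, univ_inter]
    rw [e' D, sum_comm (f := fun x y => if y ∈ S then if x ∈ Sᶜ then D x y else 0 else 0),
      e' fun y x => D x y]

/-- The product flow of a vector with zero sum, from its positive to its negative entries. -/
theorem exists_flow_of_sum_eq_zero {V : Type*} [Fintype V] [DecidableEq V] (d : V → ℝ)
    (hd : ∑ i, d i = 0) :
    ∃ D : V → V → ℝ, (∀ i j, 0 ≤ D i j) ∧
      (∀ f : V → ℝ, ∑ x, ∑ y, (f x - f y) * D x y = ∑ x, f x * d x) ∧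
      ∀ S : Finset V, ∑ x, ∑ y, (if x ∈ S ↔ y ∈ S then 0 else 1) * D x y ≤ ∑ i ∈ S, |d i| := by
  set N := ∑ i, max (d i) 0 with hN
  have hN' : ∑ i, max (-d i) 0 = N := by
    have : ∑ i, (max (d i) 0 - max (-d i) 0) = 0 := by
      refine Eq.trans ?_ hd
      refine sum_congr rfl fun i _ => ?_
      rcases le_total (d i) 0 with h | h <;> simp [h]
    rw [sum_sub_distrib] at this
    linarith
  have hN0 : 0 ≤ N := sum_nonneg fun i _ => le_max_right _ _
  have cancel : ∀ g : V → ℝ, (∀ i, 0 ≤ g i) → ∑ i, g i = N → ∀ i, g i * N / N = g i := by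
    intro g hg hs i
    rcases eq_or_ne N 0 with h | h
    · have : g i ≤ 0 := by
        rw [← h, ← hs]
        exact single_le_sum (fun i _ => hg i) (mem_univ i)
      rw [le_antisymm this (hg i)]; simp
    · field_simp
  have rowsum : ∀ x, ∑ y, max (d x) 0 * max (-d y) 0 / N = max (d x) 0 := by
    intro x
    rw [← sum_div, ← mul_sum, hN']
    exact cancel _ (fun i => le_max_right _ _) rfl x
  have colsum : ∀ y, ∑ x, max (d x) 0 * max (-d y) 0 / N = max (-d y) 0 := by
    intro y
    rw [← sum_div, ← sum_mul, mul_comm]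
    exact cancel (fun y => max (-d y) 0) (fun i => le_max_right _ _) hN' y
  have hD0 : ∀ x y, 0 ≤ max (d x) 0 * max (-d y) 0 / N := fun x y =>
    div_nonneg (mul_nonneg (le_max_right _ _) (le_max_right _ _)) hN0
  refine ⟨fun x y => max (d x) 0 * max (-d y) 0 / N, hD0, fun f => ?_, fun S => ?_⟩
  · simp only [sub_mul, sum_sub_distrib]
    rw [sum_comm (f := fun x y => f y * (max (d x) 0 * max (-d y) 0 / N))]
    simp only [← mul_sum, rowsum, colsum]
    rw [← sum_sub_distrib]
    refine sum_congr rfl fun i _ => ?_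
    rcases le_total (d i) 0 with h | h <;> simp [h]
  -- Charge each crossing arc to its end in `S`; the vertex `i` is charged its positive plus its
  -- negative part.
  · calc ∑ x, ∑ y, (if x ∈ S ↔ y ∈ S then 0 else 1) * (max (d x) 0 * max (-d y) 0 / N)
        ≤ ∑ x, ∑ y, ((if x ∈ S then max (d x) 0 * max (-d y) 0 / N else 0)
            + (if y ∈ S then max (d x) 0 * max (-d y) 0 / N else 0)) := by
          refine sum_le_sum fun x _ => sum_le_sum fun y _ => ?_
          have := hD0 x y
          by_cases a : x ∈ S <;> by_cases b : y ∈ S <;> (simp [a, b]; try linarith)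
      _ = ∑ i ∈ S, |d i| := by
          simp only [sum_add_distrib]
          rw [sum_comm (f := fun x y => if y ∈ S then max (d x) 0 * max (-d y) 0 / N else 0)]
          have e1 : ∀ x, ∑ y, (if x ∈ S then max (d x) 0 * max (-d y) 0 / N else 0)
              = if x ∈ S then max (d x) 0 else 0 := by
            intro x; split_ifs
            · exact rowsum x
            · simp
          have e2 : ∀ y, ∑ x, (if y ∈ S then max (d x) 0 * max (-d y) 0 / N else 0)
              = if y ∈ S then max (-d y) 0 else 0 := by
            intro y; split_ifs
            · exact colsum y
            · simp
          simp only [e1, e2, sum_ite_mem, univ_inter]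
          rw [← sum_add_distrib]
          refine sum_congr rfl fun i _ => ?_
          rcases le_total (d i) 0 with h | h <;> simp [h, abs_of_nonneg, abs_of_nonpos]

/-! ### Entropy of averages -/

/-- The entropy gained by averaging two nonnegative numbers is at least quadratic in their
difference. -/
theorem negMulLog_midpoint_gap {x y : ℝ} (hx : 0 ≤ x) (hy : 0 ≤ y) :
    (x - y) ^ 2 / (8 * (x + y)) ≤
      Real.negMulLog ((x + y) / 2) - (Real.negMulLog x + Real.negMulLog y) / 2 := by
  rcases eq_or_lt_of_le (add_nonneg hx hy) with h | h
  · have hx' : x = 0 := by linarith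
    have hy' : y = 0 := by linarith
    simp [hx', hy']
  set m := (x + y) / 2 with hm
  have m0 : 0 < m := by positivity
  -- This is `log t ≥ 1 - 1 / t` at `t = √(z / m)`; adding it for `x` and `y` bounds the gap below
  -- by a Hellinger-type distance.
  have key : ∀ z : ℝ, 0 ≤ z → 2 * (z - √z * √m) ≤ z * (Real.log z - Real.log m) := by
    intro z hz
    rcases eq_or_lt_of_le hz with h0 | h0
    · simp [← h0]
    have hs : 0 < √z := Real.sqrt_pos.2 h0
    have hsm : 0 < √m := Real.sqrt_pos.2 m0
    have h1 := Real.one_sub_inv_le_log_of_pos (div_pos hs hsm)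
    have h2 : Real.log (√z / √m) = (Real.log z - Real.log m) / 2 := by
      rw [Real.log_div hs.ne' hsm.ne', Real.log_sqrt hz, Real.log_sqrt m0.le]; ring
    rw [h2] at h1
    have h3 : z * (1 - (√z / √m)⁻¹) = z - √z * √m := by
      have hz' : z * (√m / √z) = √z * √m := by
        rw [mul_div_assoc', div_eq_iff hs.ne']
        linear_combination (-√m) * Real.mul_self_sqrt hz
      rw [inv_div, mul_sub, hz', mul_one]
    have := mul_le_mul_of_nonneg_left h1 hz
    rw [h3] at this
    linarith
  have kx := key x hx
  have ky := key y hy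
  have hgap : Real.negMulLog m - (Real.negMulLog x + Real.negMulLog y) / 2
      = (x * (Real.log x - Real.log m) + y * (Real.log y - Real.log m)) / 2 := by
    simp only [Real.negMulLog, hm]; ring
  rw [hgap]
  have sx := Real.mul_self_sqrt hx
  have sy := Real.mul_self_sqrt hy
  have sm := Real.mul_self_sqrt m0.le
  have nx := Real.sqrt_nonneg x
  have ny := Real.sqrt_nonneg y
  have nm := Real.sqrt_nonneg m
  have hell : (x - y) ^ 2 / (8 * (x + y)) ≤ 2 * m - (√x + √y) * √m := by
    set a := √x
    set b := √y
    set c := √m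
    rw [div_le_iff₀ (by positivity)]
    have hc : c * c = (a * a + b * b) / 2 := by rw [sm, sx, sy]
    have hab : (a + b) * (a + b) ≤ 4 * (c * c) := by nlinarith [sq_nonneg (a - b)]
    have hle : a + b ≤ 2 * c := by nlinarith
    have e1 : 2 * m - (a + b) * c = c * (2 * c - (a + b)) := by rw [← sm]; ring
    have e2 : (a - b) ^ 2 = (2 * c - (a + b)) * (2 * c + (a + b)) := by nlinarith
    have e3 : (x - y) ^ 2 = (a - b) ^ 2 * (a + b) ^ 2 := by rw [← sx, ← sy]; ring
    have e4 : x + y = 2 * (c * c) := by rw [sm, hm]; ring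
    rw [e1, e3, e2, e4]
    have hd : 0 ≤ 2 * c - (a + b) := by linarith
    have : (2 * c + (a + b)) * (a + b) ^ 2 ≤ c * (8 * (2 * (c * c))) := by
      have q1 : (a + b) ^ 2 ≤ 4 * (c * c) := by nlinarith
      have q2 : 2 * c + (a + b) ≤ 4 * c := by linarith
      calc (2 * c + (a + b)) * (a + b) ^ 2 ≤ (4 * c) * (4 * (c * c)) := by gcongr
        _ = _ := by ring
    nlinarith [mul_le_mul_of_nonneg_left this hd]
  linarith

/-- Two probability vectors at `ℓ¹` distance at least one gain entropy `1 / 16` by averaging. -/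
theorem entropy_midpoint_gap {V : Type*} [Fintype V] {p q : V → ℝ} (hp : ∀ a, 0 ≤ p a)
    (hq : ∀ a, 0 ≤ q a) (hps : ∑ a, p a = 1) (hqs : ∑ a, q a = 1) (hpq : 1 ≤ ∑ a, |p a - q a|) :
    (∑ a, Real.negMulLog (p a) + ∑ a, Real.negMulLog (q a)) / 2 + 1 / 16
      ≤ ∑ a, Real.negMulLog ((p a + q a) / 2) := by
  have h1 : ∑ a, (p a - q a) ^ 2 / (8 * (p a + q a)) ≤ ∑ a, (Real.negMulLog ((p a + q a) / 2)
      - (Real.negMulLog (p a) + Real.negMulLog (q a)) / 2) :=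
    sum_le_sum fun a _ => negMulLog_midpoint_gap (hp a) (hq a)
  rw [sum_sub_distrib, ← sum_div, sum_add_distrib] at h1
  -- A tangent-line bound replaces Cauchy–Schwarz; in total it leaves `1 / 8 - 2 / 32 = 1 / 16`.
  have h2 : ∑ a, (|p a - q a| / 8 - (p a + q a) / 32) ≤ ∑ a, (p a - q a) ^ 2 / (8 * (p a + q a)) := by
    refine sum_le_sum fun a _ => ?_
    rcases eq_or_lt_of_le (add_nonneg (hp a) (hq a)) with h | h
    · have hx' : p a = 0 := by linarith [hp a, hq a]
      have hy' : q a = 0 := by linarith [hp a, hq a]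
      simp [hx', hy']
    · rw [le_div_iff₀ (by positivity), ← sq_abs (p a - q a)]
      nlinarith [sq_nonneg (2 * |p a - q a| - (p a + q a))]
  rw [sum_sub_distrib, ← sum_div, ← sum_div, sum_add_distrib, hps, hqs] at h2
  linarith

theorem entropy_nonneg {V : Type*} [Fintype V] {p : V → ℝ} (hp : ∀ a, 0 ≤ p a)
    (hps : ∑ a, p a = 1) : 0 ≤ ∑ a, Real.negMulLog (p a) :=
  sum_nonneg fun a _ => Real.negMulLog_nonneg (hp a)
    (by rw [← hps]; exact single_le_sum (fun b _ => hp b) (mem_univ a))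

theorem entropy_le_log_card {V : Type*} [Fintype V] [Nonempty V] {p : V → ℝ} (hp : ∀ a, 0 ≤ p a)
    (hps : ∑ a, p a = 1) : ∑ a, Real.negMulLog (p a) ≤ Real.log (Fintype.card V) := by
  set N : ℝ := (Fintype.card V : ℝ) with hN
  have hN0 : 0 < N := Nat.cast_pos.2 Fintype.card_pos
  have h : ∀ a, Real.negMulLog (p a) ≤ p a * Real.log N + (1 / N - p a) := by
    intro a
    rcases eq_or_lt_of_le (hp a) with h0 | h0
    · simp [← h0, hN0.le]
    have h1 := Real.log_le_sub_one_of_pos (show 0 < 1 / (N * p a) by positivity)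
    rw [one_div, Real.log_inv, Real.log_mul hN0.ne' h0.ne'] at h1
    have h2 := mul_le_mul_of_nonneg_left h1 h0.le
    have h3 : p a * ((N * p a)⁻¹ - 1) = 1 / N - p a := by field_simp
    rw [h3] at h2
    simp only [Real.negMulLog]
    linarith
  refine (sum_le_sum fun a _ => h a).trans ?_
  rw [sum_add_distrib, sum_sub_distrib, ← sum_mul, hps]
  simp [← hN, hN0.ne']

/-! ### Measure-preserving transports and lazy random walk steps -/

/-- Probability vectors `P i` on `V`, such that moving `m i` along `P i` for every `i` preserves
the measure `m`. -/
structure IsTransport {V : Type*} [Fintype V] (m : V → ℝ) (P : V → V → ℝ) : Prop where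
  nonneg : ∀ i a, 0 ≤ P i a
  row_sum : ∀ i, ∑ a, P i a = 1
  col_sum : ∀ a, ∑ i, m i * P i a = m a

/-- The mass moved by `P` out of `S`. -/
def transportCut {V : Type*} [Fintype V] [DecidableEq V] (m : V → ℝ) (P : V → V → ℝ)
    (S : Finset V) : ℝ := ∑ i ∈ S, m i * ∑ a ∈ Sᶜ, P i a

/-- The total entropy of the rows of `P`. -/
noncomputable def transportEntropy {V : Type*} [Fintype V] (m : V → ℝ) (P : V → V → ℝ) : ℝ :=
  ∑ i, m i * ∑ a, Real.negMulLog (P i a)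

/-- One step of the lazy random walk along `M`. -/
noncomputable def mixStep {V : Type*} [Fintype V] (m : V → ℝ) (M P : V → V → ℝ) (i a : V) : ℝ :=
  P i a + ∑ j, M i j / (2 * m i) * (P j a - P i a)

section Transport

variable {V : Type*} [Fintype V] {m : V → ℝ} {M P : V → V → ℝ}

/-- Exhibits a step as a combination of the old row and of midpoints, convex once degrees are at
most `m`; the entropy estimate applies concavity in this form. -/
theorem mixStep_eq (hm : ∀ i, 0 < m i) (i a : V) : mixStep m M P i a =
    (1 - ∑ j, M i j / m i) * P i a + ∑ j, M i j / m i * ((P i a + P j a) / 2) := by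
  have h : ∀ j, M i j / m i * ((P i a + P j a) / 2)
      = M i j / (2 * m i) * (P j a - P i a) + M i j / m i * P i a := by
    intro j
    have := (hm i).ne'
    field_simp
    ring
  simp only [mixStep, h, sum_add_distrib, ← sum_mul]
  ring

theorem IsTransport.mixStep (hP : IsTransport m P) (hm : ∀ i, 0 < m i) (hM : ∀ i j, 0 ≤ M i j)
    (hs : ∀ i j, M i j = M j i) (hd : ∀ i, ∑ j, M i j ≤ m i) :
    IsTransport m (mixStep m M P) where
  nonneg i a := by
    rw [mixStep_eq hm]
    have h1 : ∑ j, M i j / m i ≤ 1 := by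
      rw [← sum_div]; exact (div_le_one (hm i)).2 (hd i)
    have h2 : 0 ≤ ∑ j, M i j / m i * ((P i a + P j a) / 2) := sum_nonneg fun j _ =>
      mul_nonneg (div_nonneg (hM i j) (hm i).le) (by linarith [hP.nonneg i a, hP.nonneg j a])
    have := mul_nonneg (sub_nonneg.2 h1) (hP.nonneg i a)
    linarith
  row_sum i := by
    simp only [_root_.mixStep, sum_add_distrib, hP.row_sum]
    rw [sum_comm]
    simp [← mul_sum, hP.row_sum]
  col_sum a := by
    have e : ∀ i, m i * _root_.mixStep m M P i a
        = m i * P i a + ∑ j, (M i j * P j a - M i j * P i a) / 2 := by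
      intro i
      simp only [_root_.mixStep, mul_add, mul_sum]
      congr 1
      refine sum_congr rfl fun j _ => ?_
      have := (hm i).ne'
      field_simp
    simp only [e, sum_add_distrib, hP.col_sum, ← sum_div, sum_sub_distrib]
    rw [sum_comm (f := fun i j => M i j * P j a)]
    simp only [hs]
    have : ∑ x, ∑ y, M x y * P x a = ∑ x, ∑ y, M y x * P x a :=
      sum_congr rfl fun x _ => sum_congr rfl fun y _ => by rw [hs]
    simp [this]

/-- If `x i` is the part of row `i` outside `S`, the step changes `m i * x i` by half of `∑ j, M i j
* (x j - x i)`. Pairs inside `S` cancel by symmetry, and crossing pairs contribute at most `M i j /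
2` because `x` takes values in `[0, 1]`. -/
theorem transportCut_mixStep_le [DecidableEq V] (hP : IsTransport m P) (hm : ∀ i, 0 < m i)
    (hM : ∀ i j, 0 ≤ M i j) (hs : ∀ i j, M i j = M j i) (S : Finset V) :
    transportCut m (mixStep m M P) S ≤ transportCut m P S + (∑ i ∈ S, ∑ j ∈ Sᶜ, M i j) / 2 := by
  set x : V → ℝ := fun i => ∑ a ∈ Sᶜ, P i a with hx
  have x0 : ∀ i, 0 ≤ x i := fun i => sum_nonneg fun a _ => hP.nonneg i a
  have x1 : ∀ i, x i ≤ 1 := fun i => by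
    rw [← hP.row_sum i]
    exact sum_le_univ_sum_of_nonneg (hP.nonneg i)
  have e : ∀ i, m i * ∑ a ∈ Sᶜ, mixStep m M P i a = m i * x i + (∑ j, M i j * (x j - x i)) / 2 := by
    intro i
    simp only [mixStep, sum_add_distrib, mul_add, hx]
    congr 1
    rw [sum_comm, mul_sum, sum_div]
    refine sum_congr rfl fun j _ => ?_
    rw [← mul_sum, sum_sub_distrib]
    have := (hm i).ne'
    field_simp
  have inner : ∑ i ∈ S, ∑ j ∈ S, M i j * (x j - x i) = 0 := by
    have h : ∑ i ∈ S, ∑ j ∈ S, M i j * (x j - x i) = ∑ i ∈ S, ∑ j ∈ S, M i j * (x i - x j) := by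
      rw [sum_comm]
      exact sum_congr rfl fun i _ => sum_congr rfl fun j _ => by rw [hs]
    have h' : ∑ i ∈ S, ∑ j ∈ S, M i j * (x j - x i) + ∑ i ∈ S, ∑ j ∈ S, M i j * (x i - x j) = 0 := by
      rw [← sum_add_distrib]
      refine sum_eq_zero fun i _ => ?_
      rw [← sum_add_distrib]
      exact sum_eq_zero fun j _ => by ring
    linarith
  have outer : ∑ i ∈ S, ∑ j ∈ Sᶜ, M i j * (x j - x i) ≤ ∑ i ∈ S, ∑ j ∈ Sᶜ, M i j :=
    sum_le_sum fun i _ => sum_le_sum fun j _ => by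
      nlinarith [hM i j, x0 i, x1 j]
  simp only [transportCut, e, sum_add_distrib, ← sum_div]
  have split : ∑ i ∈ S, ∑ j, M i j * (x j - x i) =
      ∑ i ∈ S, ∑ j ∈ S, M i j * (x j - x i) + ∑ i ∈ S, ∑ j ∈ Sᶜ, M i j * (x j - x i) := by
    rw [← sum_add_distrib]
    exact sum_congr rfl fun i _ => (sum_add_sum_compl S _).symm
  rw [split, inner]
  simp only [hx] at outer ⊢
  linarith

/-- Jensen gives row `i` the gain of its midpoints over its own entropy. Symmetrising over `i` and
`j` compares each midpoint with the mean of both entropies, where `entropy_midpoint_gap` applies. -/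
theorem transportEntropy_mixStep_ge (hP : IsTransport m P) (hm : ∀ i, 0 < m i)
    (hM : ∀ i j, 0 ≤ M i j) (hs : ∀ i j, M i j = M j i) (hd : ∀ i, ∑ j, M i j ≤ m i)
    (hfar : ∀ i j, M i j ≠ 0 → 1 ≤ ∑ a, |P i a - P j a|) :
    transportEntropy m P + (∑ i, ∑ j, M i j) / 16 ≤ transportEntropy m (mixStep m M P) := by
  set H : V → ℝ := fun i => ∑ a, Real.negMulLog (P i a) with hH
  set K : V → V → ℝ := fun i j => ∑ a, Real.negMulLog ((P i a + P j a) / 2) with hK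
  have jensen : ∀ i, m i * H i + ∑ j, M i j * (K i j - H i)
      ≤ m i * ∑ a, Real.negMulLog (mixStep m M P i a) := by
    intro i
    have h1 : ∑ j, M i j / m i ≤ 1 := by
      rw [← sum_div]; exact (div_le_one (hm i)).2 (hd i)
    have h : ∀ a, (1 - ∑ j, M i j / m i) * Real.negMulLog (P i a)
        + ∑ j, M i j / m i * Real.negMulLog ((P i a + P j a) / 2)
          ≤ Real.negMulLog (mixStep m M P i a) := by
      intro a
      -- The index `none` carries the weight that stays at `i`.
      have := Real.concaveOn_negMulLog.le_map_sum (t := (univ : Finset (Option V)))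
        (w := fun o => o.elim (1 - ∑ j, M i j / m i) (fun j => M i j / m i))
        (p := fun o => o.elim (P i a) (fun j => (P i a + P j a) / 2))
        (by rintro (_ | j) -
            · simpa using h1
            · exact div_nonneg (hM i j) (hm i).le)
        (by simp [Fintype.sum_option])
        (by rintro (_ | j) -
            · exact hP.nonneg i a
            · have := hP.nonneg i a
              have := hP.nonneg j a
              simp only [Option.elim, Set.mem_Ici]
              linarith)
      simp only [Fintype.sum_option, Option.elim, smul_eq_mul] at this
      rwa [← mixStep_eq hm] at this
    have h2 := mul_le_mul_of_nonneg_left (sum_le_sum fun a (_ : a ∈ univ) => h a) (hm i).le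
    refine le_of_eq_of_le ?_ h2
    rw [sum_add_distrib, ← mul_sum, sum_comm]
    simp only [← mul_sum]
    have e : ∀ j, M i j / m i * K i j = (M i j * K i j) / m i := fun j => by ring
    simp only [mul_sub, sum_sub_distrib]
    change _ = m i * ((1 - ∑ j, M i j / m i) * H i + ∑ j, M i j / m i * K i j)
    simp only [e, ← sum_div, ← sum_mul]
    have := (hm i).ne'
    field_simp
    ring
  have total := sum_le_sum fun i (_ : i ∈ univ) => jensen i
  rw [sum_add_distrib] at total
  have swap : ∑ i, ∑ j, M i j * (K i j - H i) = ∑ i, ∑ j, M i j * (K i j - H j) := by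
    rw [sum_comm]
    refine sum_congr rfl fun i _ => sum_congr rfl fun j _ => ?_
    have : K i j = K j i := by simp only [hK, add_comm]
    rw [hs, this]
  have gap : ∑ i, ∑ j, M i j / 8 ≤ ∑ i, ∑ j, (M i j * (K i j - H i) + M i j * (K i j - H j)) := by
    refine sum_le_sum fun i _ => sum_le_sum fun j _ => ?_
    by_cases h : M i j = 0
    · simp [h]
    have := entropy_midpoint_gap (hP.nonneg i) (hP.nonneg j) (hP.row_sum i) (hP.row_sum j)
      (hfar i j h)
    nlinarith [hM i j]
  simp only [sum_add_distrib, ← sum_div] at gap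
  simp only [transportEntropy]
  linarith

theorem transportEntropy_nonneg (hP : IsTransport m P) (hm : ∀ i, 0 < m i) :
    0 ≤ transportEntropy m P :=
  sum_nonneg fun i _ => mul_nonneg (hm i).le (entropy_nonneg (hP.nonneg i) (hP.row_sum i))

theorem transportEntropy_le [Nonempty V] (hP : IsTransport m P) (hm : ∀ i, 0 < m i) :
    transportEntropy m P ≤ (∑ i, m i) * Real.log (Fintype.card V) := by
  rw [sum_mul]
  exact sum_le_sum fun i _ => mul_le_mul_of_nonneg_left
    (entropy_le_log_card (hP.nonneg i) (hP.row_sum i)) (hm i).le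

theorem isTransport_id [DecidableEq V] (m : V → ℝ) :
    IsTransport m (fun i a => if i = a then 1 else 0) where
  nonneg i a := by split_ifs <;> norm_num
  row_sum i := by simp
  col_sum a := by simp

theorem transportCut_id [DecidableEq V] (m : V → ℝ) (S : Finset V) :
    transportCut m (fun i a => if i = a then 1 else 0) S = 0 := by
  refine sum_eq_zero fun i hi => ?_
  simp [hi]

theorem transportCut_nonneg [DecidableEq V] (hP : IsTransport m P) (hm : ∀ i, 0 < m i)
    (S : Finset V) : 0 ≤ transportCut m P S :=
  sum_nonneg fun i _ => mul_nonneg (hm i).le (sum_nonneg fun a _ => hP.nonneg i a)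

/-- As `m` is preserved, the mass leaving `S` equals the mass entering it. -/
theorem transportCut_compl [DecidableEq V] (hP : IsTransport m P) (S : Finset V) :
    transportCut m P Sᶜ = transportCut m P S := by
  have h1 : ∑ i ∈ S, m i = transportCut m P S + ∑ i ∈ S, m i * ∑ a ∈ S, P i a := by
    rw [transportCut, ← sum_add_distrib]
    refine sum_congr rfl fun i _ => ?_
    rw [← mul_add, add_comm, sum_add_sum_compl, hP.row_sum, mul_one]
  have h2 : ∑ a ∈ S, m a = transportCut m P Sᶜ + ∑ i ∈ S, m i * ∑ a ∈ S, P i a := by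
    rw [transportCut, compl_compl, add_comm, sum_add_sum_compl]
    simp only [mul_sum]
    rw [sum_comm]
    exact sum_congr rfl fun a _ => (hP.col_sum a).symm
  linarith

theorem transportCut_union_le [DecidableEq V] (hP : IsTransport m P) (hm : ∀ i, 0 < m i)
    (S T : Finset V) :
    transportCut m P (S ∪ T) ≤ transportCut m P S + transportCut m P T := by
  have mono : ∀ A B : Finset V, A ⊆ B → ∀ i, m i * ∑ a ∈ Bᶜ, P i a ≤ m i * ∑ a ∈ Aᶜ, P i a :=
    fun A B h i => mul_le_mul_of_nonneg_left
      (sum_le_sum_of_subset_of_nonneg (compl_subset_compl.2 h) fun a _ _ => hP.nonneg i a) (hm i).le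
  have nn : ∀ A : Finset V, ∀ i, 0 ≤ m i * ∑ a ∈ Aᶜ, P i a :=
    fun A i => mul_nonneg (hm i).le (sum_nonneg fun a _ => hP.nonneg i a)
  calc transportCut m P (S ∪ T)
      ≤ ∑ i ∈ S, m i * ∑ a ∈ (S ∪ T)ᶜ, P i a + ∑ i ∈ T, m i * ∑ a ∈ (S ∪ T)ᶜ, P i a := by
        rw [transportCut, ← sum_union_inter]
        linarith [sum_nonneg fun i (_ : i ∈ S ∩ T) => nn (S ∪ T) i]
    _ ≤ _ := add_le_add (sum_le_sum fun i _ => mono S _ subset_union_left i)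
        (sum_le_sum fun i _ => mono T _ subset_union_right i)

/-- All but `4 Q(S)` of the mass of `S` keeps at least three quarters of itself in `S`. -/
theorem sum_filter_ge [DecidableEq V] (hP : IsTransport m P) (hm : ∀ i, 0 < m i) (S : Finset V) :
    ∑ i ∈ S, m i - 4 * transportCut m P S ≤ ∑ i ∈ S with ∑ a ∈ Sᶜ, P i a ≤ 1 / 4, m i := by
  rw [← sum_filter_add_sum_filter_not S (fun i => ∑ a ∈ Sᶜ, P i a ≤ 1 / 4) m, transportCut, mul_sum]
  have h1 : ∑ i ∈ S with ¬ ∑ a ∈ Sᶜ, P i a ≤ 1 / 4, m i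
      ≤ ∑ i ∈ S with ¬ ∑ a ∈ Sᶜ, P i a ≤ 1 / 4, 4 * (m i * ∑ a ∈ Sᶜ, P i a) := by
    refine sum_le_sum fun i hi => ?_
    have := (mem_filter.1 hi).2
    nlinarith [hm i]
  have h2 : ∑ i ∈ S with ¬ ∑ a ∈ Sᶜ, P i a ≤ 1 / 4, 4 * (m i * ∑ a ∈ Sᶜ, P i a)
      ≤ ∑ i ∈ S, 4 * (m i * ∑ a ∈ Sᶜ, P i a) :=
    sum_le_sum_of_subset_of_nonneg (filter_subset _ _) fun i _ _ => by
      have := mul_nonneg (hm i).le (sum_nonneg fun a (_ : a ∈ Sᶜ) => hP.nonneg i a)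
      linarith
  linarith

theorem one_le_sum_abs_sub [DecidableEq V] {p q : V → ℝ} (hps : ∑ a, p a = 1)
    (hqs : ∑ a, q a = 1) (S : Finset V) (hp : ∑ a ∈ Sᶜ, p a ≤ 1 / 4) (hq : ∑ a ∈ S, q a ≤ 1 / 4) :
    1 ≤ ∑ a, |p a - q a| := by
  rw [← sum_add_sum_compl S] at hps hqs ⊢
  have h1 : ∑ a ∈ S, (p a - q a) ≤ ∑ a ∈ S, |p a - q a| := sum_le_sum fun a _ => le_abs_self _
  have h2 : ∑ a ∈ Sᶜ, (q a - p a) ≤ ∑ a ∈ Sᶜ, |p a - q a| :=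
    sum_le_sum fun a _ => by rw [abs_sub_comm]; exact le_abs_self _
  rw [sum_sub_distrib] at h1 h2
  linarith

end Transport

/-! ### Hypergraph flows, submodular cut functions and seeds -/

/-- A hypergraph flow routes a symmetric weighted graph with its demands as degrees. -/
theorem exists_matching_of_hypergraphFlow {n : ℕ} (E : Finset (Finset (Fin n)))
    (Y : HypergraphFlow n) (hY : ∀ h ∈ E, ∑ i ∈ h, Y h i = 0) :
    ∃ M : Fin n → Fin n → ℝ, (∀ i j, 0 ≤ M i j) ∧ (∀ i j, M i j = M j i) ∧
      (∀ i, ∑ j, M i j = |∑ h ∈ E with i ∈ h, Y h i|) ∧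
      (∀ i j, M i j ≠ 0 → (∑ h ∈ E with i ∈ h, Y h i) * (∑ h ∈ E with j ∈ h, Y h j) < 0) ∧
      ∀ S : Finset (Fin n), ∑ i ∈ S, ∑ j ∈ Sᶜ, M i j
        ≤ ∑ h ∈ E, min (∑ i ∈ S ∩ h, |Y h i|) (∑ i ∈ h \ S, |Y h i|) := by
  let y : Finset (Fin n) → Fin n → ℝ := fun h i => if i ∈ h then Y h i else 0
  have hy : ∀ h ∈ E, ∑ i, y h i = 0 := fun h hh => by
    simp only [y, sum_ite_mem, univ_inter]; exact hY h hh
  -- Each hyperedge is routed separately, which keeps its crossing flow below the total variation on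
  -- either side; only the sum of these flows is then shortcut.
  have hex : ∀ h, ∃ D : Fin n → Fin n → ℝ, h ∈ E → (∀ i j, 0 ≤ D i j) ∧
      (∀ f : Fin n → ℝ, ∑ a, ∑ b, (f a - f b) * D a b = ∑ a, f a * y h a) ∧
      ∀ S : Finset (Fin n), ∑ a, ∑ b, (if a ∈ S ↔ b ∈ S then 0 else 1) * D a b
        ≤ ∑ i ∈ S, |y h i| := by
    intro h
    by_cases hh : h ∈ E
    · obtain ⟨D, hD⟩ := exists_flow_of_sum_eq_zero (y h) (hy h hh)
      exact ⟨D, fun _ => hD⟩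
    · exact ⟨0, fun h' => absurd h' hh⟩
  choose D hD using hex
  have pull : ∀ φ : Fin n → Fin n → ℝ, ∑ a, ∑ b, φ a b * ∑ h ∈ E, D h a b
      = ∑ h ∈ E, ∑ a, ∑ b, φ a b * D h a b := by
    intro φ
    simp only [mul_sum]
    rw [sum_comm (s := E)]
    refine sum_congr rfl fun a _ => ?_
    rw [sum_comm]
  obtain ⟨M, h1, h2, h3, h4, h5⟩ := exists_symm_matching (fun a b => ∑ h ∈ E, D h a b)
    (fun a b => sum_nonneg fun h hh => (hD h hh).1 a b) (fun i => ∑ h ∈ E with i ∈ h, Y h i) (by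
      intro f
      rw [pull, sum_congr rfl fun h hh => (hD h hh).2.1 f, sum_comm]
      refine sum_congr rfl fun a _ => ?_
      rw [← mul_sum, sum_filter])
  have habs : ∀ h ∈ E, ∀ S : Finset (Fin n),
      ∑ a, ∑ b, (if a ∈ S ↔ b ∈ S then 0 else 1) * D h a b ≤ ∑ i ∈ S ∩ h, |Y h i| := by
    intro h hh S
    refine ((hD h hh).2.2 S).trans (le_of_eq ?_)
    rw [← sum_ite_mem]
    refine sum_congr rfl fun i _ => ?_
    simp only [y]
    split_ifs <;> simp
  refine ⟨M, h1, h2, h3, h4, fun S => (h5 S).trans ?_⟩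
  rw [pull]
  refine sum_le_sum fun h hh => le_min (habs h hh S) ?_
  have := habs h hh Sᶜ
  simp only [mem_compl, not_iff_not] at this
  have hS : Sᶜ ∩ h = h \ S := by
    ext i
    simp only [mem_inter, mem_compl, mem_sdiff]
    tauto
  rwa [hS] at this

namespace IsMSCF

variable {n : ℕ} {h : Finset (Fin n)} {δ : Finset (Fin n) → ℝ}

theorem nonneg (hδ : IsMSCF h δ) {S : Finset (Fin n)} (hS : S ⊆ h) : 0 ≤ δ S := by
  obtain ⟨F, h0, hmono, -, hmin⟩ := hδ
  rw [hmin S hS]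
  refine le_min ?_ ?_
  · rw [← h0]; exact hmono _ _ (Finset.empty_subset _) hS
  · rw [← h0]; exact hmono _ _ (Finset.empty_subset _) Finset.sdiff_subset

theorem apply_self (hδ : IsMSCF h δ) : δ h = 0 := by
  obtain ⟨F, h0, hmono, -, hmin⟩ := hδ
  rw [hmin h subset_rfl, Finset.sdiff_self]
  have := hmono ∅ h (Finset.empty_subset _) subset_rfl
  rw [min_eq_right this, h0]

theorem apply_sdiff (hδ : IsMSCF h δ) {S : Finset (Fin n)} (hS : S ⊆ h) : δ (h \ S) = δ S := by
  obtain ⟨F, -, -, -, hmin⟩ := hδ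
  rw [hmin _ hS, hmin _ Finset.sdiff_subset, Finset.sdiff_sdiff_eq_self hS, min_comm]

/-- The total variation of a vector of the base polytope on a set and on its complement is bounded
by the cut function. -/
theorem min_sum_abs_le (hδ : IsMSCF h δ) {c : ℝ} (hc : 0 ≤ c) {y : Fin n → ℝ}
    (hy : ∑ i ∈ h, y i = 0) (hle : ∀ S ⊆ h, ∑ i ∈ S, y i ≤ c * δ S) {S : Finset (Fin n)}
    (hS : S ⊆ h) : min (∑ i ∈ S, |y i|) (∑ i ∈ h \ S, |y i|) ≤ 2 * (c * δ S) := by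
  obtain ⟨F, h0, hmono, -, hmin⟩ := hδ
  -- Since `y` sums to zero on `h`, its total variation on `T` is `y(Tp) + y(h \ Tn)`. Both `δ Tp`
  -- and `δ (h \ Tn)` are at most `F T` by monotonicity, the second because `δ` may be evaluated on
  -- the complement `Tn`.
  have key : ∀ T ⊆ h, ∑ i ∈ T, |y i| ≤ 2 * (c * F T) := by
    intro T hT
    set Tp := T.filter (fun i => 0 ≤ y i)
    set Tn := T.filter (fun i => ¬ 0 ≤ y i)
    have hp : Tp ⊆ T := filter_subset _ _
    have hn : Tn ⊆ T := filter_subset _ _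
    have e : ∑ i ∈ T, |y i| = ∑ i ∈ Tp, y i - ∑ i ∈ Tn, y i := by
      rw [← sum_filter_add_sum_filter_not T (fun i => 0 ≤ y i), sub_eq_add_neg, ← sum_neg_distrib]
      congr 1
      · exact sum_congr rfl fun i hi => abs_of_nonneg (mem_filter.1 hi).2
      · exact sum_congr rfl fun i hi => abs_of_neg (not_le.1 (mem_filter.1 hi).2)
    have b1 : ∑ i ∈ Tp, y i ≤ c * F T := by
      refine (hle Tp (hp.trans hT)).trans (mul_le_mul_of_nonneg_left ?_ hc)
      rw [hmin _ (hp.trans hT)]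
      exact (min_le_left _ _).trans (hmono _ _ hp hT)
    have b2 : ∑ i ∈ h \ Tn, y i ≤ c * F T := by
      refine (hle (h \ Tn) sdiff_subset).trans (mul_le_mul_of_nonneg_left ?_ hc)
      rw [hmin _ sdiff_subset, Finset.sdiff_sdiff_eq_self (hn.trans hT)]
      exact (min_le_right _ _).trans (hmono _ _ hn hT)
    have b3 := sum_sdiff (f := y) (hn.trans hT)
    linarith
  rw [hmin S hS]
  rcases le_total (F S) (F (h \ S)) with hF | hF
  · rw [min_eq_left hF]; exact (min_le_left _ _).trans (key S hS)
  · rw [min_eq_right hF]; exact (min_le_right _ _).trans (key _ sdiff_subset)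

end IsMSCF

namespace MSCFHypergraph

variable {n : ℕ} (G : MSCFHypergraph n)

theorem cut_nonneg (S : Finset (Fin n)) : 0 ≤ G.cut S :=
  sum_nonneg fun h hh => mul_nonneg (Nat.cast_nonneg _) ((G.mscf h hh).nonneg inter_subset_right)

theorem cut_compl (S : Finset (Fin n)) : G.cut Sᶜ = G.cut S := by
  refine sum_congr rfl fun h hh => ?_
  rw [← (G.mscf h hh).apply_sdiff inter_subset_right]
  congr 2
  ext i
  simp only [mem_sdiff, mem_inter, mem_compl]
  tauto

variable {G} in
theorem IsFeasibleFlow.sum_eq_zero {Y : HypergraphFlow n} (hY : G.IsFeasibleFlow Y)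
    {h : Finset (Fin n)} (hh : h ∈ G.E) : ∑ i ∈ h, Y h i = 0 := by
  rw [(hY h hh).1, (G.mscf h hh).apply_self, mul_zero]

variable {G} in
theorem IsFeasibleFlow.sum_min_le {Y : HypergraphFlow n} (hY : G.IsFeasibleFlow Y)
    (S : Finset (Fin n)) :
    ∑ h ∈ G.E, min (∑ i ∈ S ∩ h, |Y h i|) (∑ i ∈ h \ S, |Y h i|) ≤ 2 * G.cut S := by
  rw [cut, mul_sum]
  refine sum_le_sum fun h hh => ?_
  have := (G.mscf h hh).min_sum_abs_le (Nat.cast_nonneg (G.w h)) (hY.sum_eq_zero hh) (hY h hh).2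
    (inter_subset_right (s₁ := S))
  rwa [sdiff_inter_self_right] at this

variable {G} in
theorem sum_dem_eq {Y : HypergraphFlow n} (S : Finset (Fin n)) :
    ∑ i ∈ S, G.dem Y i = ∑ h ∈ G.E, ∑ i ∈ S ∩ h, Y h i := by
  simp only [dem, sum_filter]
  rw [sum_comm]
  exact sum_congr rfl fun h _ => by rw [sum_ite_mem]

variable {G} in
theorem IsFeasibleFlow.sum_dem_le_cut {Y : HypergraphFlow n} (hY : G.IsFeasibleFlow Y)
    (S : Finset (Fin n)) : ∑ i ∈ S, G.dem Y i ≤ G.cut S := by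
  rw [sum_dem_eq]
  exact sum_le_sum fun h hh => (hY h hh).2 _ inter_subset_right

variable {G} in
theorem IsFeasibleFlow.sum_dem_univ {Y : HypergraphFlow n} (hY : G.IsFeasibleFlow Y) :
    ∑ i, G.dem Y i = 0 := by
  rw [sum_dem_eq]
  refine Finset.sum_eq_zero fun h hh => ?_
  rw [univ_inter]
  exact hY.sum_eq_zero hh

-- Mean zero makes the correlations with `S` and `Sᶜ` opposite, so both volumes bound them. Hence
-- the improvement objective dominates the ratio-cut, and every reply yields an honest cut.
variable {G} in
theorem IsSeed.abs_corr_le {s : Fin n → ℝ} (hs : G.IsSeed s) (S : Finset (Fin n)) :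
    |G.corr s S| ≤ min (G.vol S) (G.vol Sᶜ) := by
  have key : ∀ T : Finset (Fin n), |G.corr s T| ≤ G.vol T := fun T => by
    refine (abs_sum_le_sum_abs _ _).trans (sum_le_sum fun i _ => ?_)
    rw [abs_mul, Nat.abs_cast]
    exact mul_le_of_le_one_right (Nat.cast_nonneg _) (hs.2.1 i)
  refine le_min (key S) ?_
  have : G.corr s S = - G.corr s Sᶜ := by
    have h1 := sum_add_sum_compl S fun i => (G.μ i : ℝ) * s i
    rw [hs.1] at h1
    simp only [corr]
    linarith
  rw [this, abs_neg]
  exact key Sᶜ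

variable {G} in
theorem IsSeed.isCut {s : Fin n → ℝ} (hs : G.IsSeed s) {A : Finset (Fin n)}
    (hA : G.corr s A ≠ 0) : G.IsCut A :=
  (abs_pos.2 hA).trans_le (hs.abs_corr_le A)

variable {G} in
theorem IsSeed.ratioCut_le {s : Fin n → ℝ} (hs : G.IsSeed s) {A : Finset (Fin n)}
    (hA : G.corr s A ≠ 0) : G.ratioCut A ≤ G.improvement s A :=
  div_le_div_of_nonneg_left (G.cut_nonneg A) (abs_pos.2 hA) (hs.abs_corr_le A)

theorem ratioCut_nonneg {S : Finset (Fin n)} (hS : G.IsCut S) : 0 ≤ G.ratioCut S :=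
  div_nonneg (G.cut_nonneg S) (le_of_lt hS)

end MSCFHypergraph

/-- The convex combination of two disjointly supported weightings that has mean zero. -/
theorem seed_of_disjoint {V : Type*} [Fintype V] {m u v : V → ℝ} (hm : ∀ i, 0 < m i)
    (hu : ∀ i, 0 ≤ u i ∧ u i ≤ 1) (hv : ∀ i, 0 ≤ v i ∧ v i ≤ 1) (huv : ∀ i, u i = 0 ∨ v i = 0)
    (hpos : 0 < ∑ i, m i * u i) (hle : ∑ i, m i * u i ≤ ∑ i, m i * v i) :
    ∃ c : ℝ, 0 < c ∧ c ≤ 1 ∧ ∑ i, m i * (u i - c * v i) = 0 ∧ (∀ i, |u i - c * v i| ≤ 1) ∧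
      (∃ i, m i * (u i - c * v i) ≠ 0) ∧ ∑ i, m i * |u i - c * v i| = 2 * ∑ i, m i * u i := by
  -- The multiplier of `v` is `R / R'`, forced by mean zero and at most 1 because `u` has the
  -- smaller mass.
  set R := ∑ i, m i * u i
  set R' := ∑ i, m i * v i
  have hR' : 0 < R' := hpos.trans_le hle
  have hc : R / R' * R' = R := div_mul_cancel₀ _ hR'.ne'
  have c0 : 0 < R / R' := div_pos hpos hR'
  have c1 : R / R' ≤ 1 := (div_le_one hR').2 hle
  set c := R / R'
  have habs : ∀ i, |u i - c * v i| = u i + c * v i := by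
    intro i
    rcases huv i with h | h
    · rw [h, zero_sub, abs_neg, abs_of_nonneg (mul_nonneg c0.le (hv i).1), zero_add]
    · rw [h, mul_zero, sub_zero, add_zero, abs_of_nonneg (hu i).1]
  have hsum : ∑ i, m i * |u i - c * v i| = 2 * R := by
    have : ∀ i, m i * |u i - c * v i| = m i * u i + c * (m i * v i) := fun i => by rw [habs]; ring
    simp only [this, sum_add_distrib, ← mul_sum]
    change R + c * R' = _
    linarith
  refine ⟨c, c0, c1, ?_, fun i => ?_, ?_, hsum⟩
  · have : ∀ i, m i * (u i - c * v i) = m i * u i - c * (m i * v i) := fun i => by ring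
    simp only [this, sum_sub_distrib, ← mul_sum]
    change R - c * R' = 0
    linarith
  · rw [habs]
    rcases huv i with h | h
    · rw [h, zero_add]; exact mul_le_one₀ c1 (hv i).1 (hv i).2
    · rw [h, mul_zero, add_zero]; exact (hu i).2
  · by_contra hcon
    push Not at hcon
    have : ∑ i, m i * |u i - c * v i| = 0 := sum_eq_zero fun i _ => by
      rw [(mul_eq_zero.1 (hcon i)).resolve_left (hm i).ne', abs_zero, mul_zero]
    linarith

/-- The reply of the oracle, with the routed demands scaled by the dual value. -/
theorem IsApproxPrimalDual.normalized {n : ℕ} {G : MSCFHypergraph n} {ε : ℝ} {s : Fin n → ℝ}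
    {r : PrimalDualReply n} (h : IsApproxPrimalDual G ε s r) (hα : 0 < r.α) :
    (∀ i, 0 ≤ G.dem r.Y i / r.α * s i) ∧ (∀ i, |G.dem r.Y i / r.α| ≤ (G.μ i : ℝ) * |s i|) ∧
      ∑ i, |(G.μ i : ℝ) * s i - G.dem r.Y i / r.α| ≤ ε * ∑ i, (G.μ i : ℝ) * |s i| := by
  obtain ⟨-, -, h1, h2, -, -⟩ := h
  refine ⟨fun i => ?_, fun i => ?_, ?_⟩
  · rw [div_mul_eq_mul_div]
    exact div_nonneg (h1 i).1 hα.le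
  · rw [abs_div, abs_of_pos hα, div_le_iff₀ hα, mul_comm _ r.α]
    exact (h1 i).2
  · have e1 : ∀ i, |(G.μ i : ℝ) * s i - G.dem r.Y i / r.α|
        = |r.α * ((G.μ i : ℝ) * s i) - G.dem r.Y i| / r.α := by
      intro i
      rw [← abs_of_pos hα, ← abs_div, abs_of_pos hα, sub_div, mul_div_cancel_left₀ _ hα.ne']
    have e2 : ∀ i, |r.α * ((G.μ i : ℝ) * s i)| = r.α * ((G.μ i : ℝ) * |s i|) := by
      intro i
      rw [abs_mul, abs_mul, abs_of_pos hα, Nat.abs_cast]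
    simp only [e2, ← mul_sum] at h2
    simp only [e1, ← sum_div]
    rw [div_le_iff₀ hα]
    linarith

/-! ### Adaptive procedures and certificates -/

/-- Some procedure finds a `κ`-approximate minimum ratio-cut with at most `m` calls of any
`ε`-approximate oracle for any hypergraph in the class `I`. -/
def Solvable {n : ℕ} (ε κ : ℝ) (m : ℕ) (I : MSCFHypergraph n → Prop) : Prop :=
  ∃ p : OracleProcedure n, ∀ G, I G → ∀ O, IsApproxOracle G ε O →
    G.IsApproxMinRatioCut κ (p.result O) ∧ p.calls O ≤ m

section Solvable

variable {n : ℕ} {ε κ : ℝ} {m : ℕ} {I J : MSCFHypergraph n → Prop}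

theorem Solvable.mono (h : Solvable ε κ m J) (hIJ : ∀ G, I G → J G) : Solvable ε κ m I := by
  obtain ⟨p, hp⟩ := h
  exact ⟨p, fun G hG => hp G (hIJ G hG)⟩

theorem Solvable.mono_calls {m' : ℕ} (h : Solvable ε κ m I) (hm : m ≤ m') : Solvable ε κ m' I := by
  obtain ⟨p, hp⟩ := h
  exact ⟨p, fun G hG O hO => ⟨(hp G hG O hO).1, (hp G hG O hO).2.trans hm⟩⟩

theorem Solvable.of_nonempty (h : ∀ G, I G → Solvable ε κ m I) : Solvable ε κ m I := by
  by_cases hI : ∃ G, I G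
  · obtain ⟨G, hG⟩ := hI
    exact h G hG
  · exact ⟨.output ∅, fun G hG => absurd ⟨G, hG⟩ hI⟩

theorem Solvable.output {A : Finset (Fin n)} (h : ∀ G, I G → G.IsApproxMinRatioCut κ A) :
    Solvable ε κ m I :=
  ⟨.output A, fun G hG _ _ => ⟨h G hG, Nat.zero_le _⟩⟩

/-- To solve by calling the oracle, it suffices to solve after every reply with a positive dual
value. -/
theorem Solvable.call (hκ : 0 ≤ κ) {s : Fin n → ℝ} (hs : ∀ G, I G → G.IsSeed s)
    (h : ∀ r : PrimalDualReply n, 0 < r.α → Solvable ε κ m fun G =>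
      I G ∧ IsApproxPrimalDual G ε s r ∧ G.IsCut r.A ∧ G.ratioCut r.A ≤ 2 * r.α) :
    Solvable ε κ (m + 1) I := by
  have h' : ∀ r : PrimalDualReply n, Solvable ε κ m fun G => I G ∧ IsApproxPrimalDual G ε s r := by
    intro r
    have facts : ∀ G, I G → IsApproxPrimalDual G ε s r →
        0 ≤ r.α ∧ G.IsCut r.A ∧ G.ratioCut r.A ≤ 2 * r.α := fun G hG hr =>
      ⟨hr.1, (hs G hG).isCut hr.2.2.2.2.1,
        ((hs G hG).ratioCut_le hr.2.2.2.2.1).trans hr.2.2.2.2.2⟩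
    rcases lt_or_ge 0 r.α with hα | hα
    · exact (h r hα).mono fun G hG => ⟨hG.1, hG.2, (facts G hG.1 hG.2).2⟩
    -- A zero dual value forces `r.A` to have ratio at most zero, hence to be optimal.
    · refine Solvable.output (A := r.A) fun G hG => ?_
      obtain ⟨h0, h1, h2⟩ := facts G hG.1 hG.2
      exact ⟨h1, fun S hS => by
        have := mul_nonneg hκ (G.ratioCut_nonneg hS)
        linarith⟩
  choose p hp using h'
  refine ⟨.call s p, fun G hG O hO => ?_⟩
  obtain ⟨h1, h2⟩ := hp (O s) G ⟨hG, hO s (hs G hG)⟩ O hO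
  exact ⟨h1, Nat.succ_le_succ h2⟩

end Solvable

/-- The hypergraphs with hyperedges `E` and vertex weights `μ` in which the cut `A` has ratio at
most `2 a`, and for which `t` oracle calls have certified the lower bound `a B / t` on cuts. -/
structure Certified {n : ℕ} (E : Finset (Finset (Fin n))) (μ : Fin n → ℕ) (a : ℝ)
    (A : Finset (Fin n)) (t : ℕ) (B : Finset (Fin n) → ℝ) (G : MSCFHypergraph n) : Prop where
  edges : G.E = E
  weights : G.μ = μ
  isCut : G.IsCut A
  ratioCut_le : G.ratioCut A ≤ 2 * a
  bound : ∀ S, a * B S ≤ t * G.cut S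

section Certified

variable {n : ℕ} {ε : ℝ} {E : Finset (Finset (Fin n))} {μ : Fin n → ℕ} {a : ℝ}
  {A : Finset (Fin n)} {t m T : ℕ} {B : Finset (Fin n) → ℝ}

theorem Certified.isApprox {G : MSCFHypergraph n} (h : Certified E μ a A t B G) (ha : 0 < a)
    (hB : ∀ S, ∑ i ∈ S, (μ i : ℝ) ≤ ∑ i ∈ Sᶜ, (μ i : ℝ) → (∑ i ∈ S, (μ i : ℝ)) / 64 ≤ B S)
    (ht : t ≤ T) : G.IsApproxMinRatioCut (128 * T) A := by
  refine ⟨h.isCut, fun S hS => h.ratioCut_le.trans ?_⟩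
  have key : ∀ S, G.vol S ≤ G.vol Sᶜ → a * G.vol S ≤ 64 * T * G.cut S := by
    intro S hS
    simp only [MSCFHypergraph.vol, h.weights] at hS ⊢
    have h1 := mul_le_mul_of_nonneg_left (hB S hS) ha.le
    have h2 := h.bound S
    have h3 : (t : ℝ) * G.cut S ≤ T * G.cut S :=
      mul_le_mul_of_nonneg_right (Nat.cast_le.2 ht) (G.cut_nonneg S)
    linarith
  have hmin : a * min (G.vol S) (G.vol Sᶜ) ≤ 64 * T * G.cut S := by
    rcases le_total (G.vol S) (G.vol Sᶜ) with hle | hle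
    · rw [min_eq_left hle]; exact key S hle
    · rw [min_eq_right hle, ← G.cut_compl]
      exact key Sᶜ (by rwa [compl_compl])
  rw [MSCFHypergraph.ratioCut, mul_div_assoc', le_div_iff₀ hS]
  linarith

/-- One oracle call that improves the certificate from `B` to some `B'`. -/
theorem Solvable.certified_call (ha : 0 < a) {s : Fin n → ℝ}
    (hs : ∀ G, Certified E μ a A t B G → G.IsSeed s)
    (h : ∀ r : PrimalDualReply n, 0 < r.α → ∀ G, Certified E μ a A t B G →
      IsApproxPrimalDual G ε s r → ∃ B' : Finset (Fin n) → ℝ,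
        (∀ G : MSCFHypergraph n, G.E = E → G.μ = μ → G.IsFeasibleFlow r.Y →
          ∀ S, r.α * (B' S - B S) ≤ G.cut S) ∧
        ∀ a', 0 < a' → ∀ A', Solvable ε (128 * T) m (Certified E μ a' A' (t + 1) B')) :
    Solvable ε (128 * T) (m + 1) (Certified E μ a A t B) := by
  refine Solvable.call (by positivity) hs fun r hα => Solvable.of_nonempty ?_
  rintro G ⟨hG, hr, -, -⟩
  obtain ⟨B', hB', hsolve⟩ := h r hα G hG hr
  -- Keeping the smaller dual value with its own cut preserves both the ratio bound and the lower
  -- bounds already collected.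
  refine (hsolve (min a r.α) (lt_min ha hα) (if a ≤ r.α then A else r.A)).mono ?_
  rintro G' ⟨hG', hr', hcut, hratio⟩
  refine ⟨hG'.edges, hG'.weights, ?_, ?_, fun S => ?_⟩
  · split_ifs
    · exact hG'.isCut
    · exact hcut
  · split_ifs with hle
    · rw [min_eq_left hle]; exact hG'.ratioCut_le
    · rw [min_eq_right (not_le.1 hle).le]; exact hratio
  · have h1 := hG'.bound S
    have h2 := hB' G' hG'.edges hG'.weights hr'.2.1 S
    have h0 := G'.cut_nonneg S
    have ht0 : 0 ≤ (t : ℝ) * G'.cut S := mul_nonneg (Nat.cast_nonneg _) h0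
    -- The increment `B' S - B S` may be negative, so lowering the multiplier needs a nonnegative
    -- right-hand side.
    have scale : ∀ x y c : ℝ, 0 ≤ x → x ≤ y → 0 ≤ c → ∀ z, y * z ≤ c → x * z ≤ c := by
      intro x y c hx hxy hc z hz
      rcases le_total 0 z with h | h
      · exact (mul_le_mul_of_nonneg_right hxy h).trans hz
      · exact (mul_nonpos_of_nonneg_of_nonpos hx h).trans hc
    have hmin0 : 0 ≤ min a r.α := (lt_min ha hα).le
    have b1 := scale _ _ _ hmin0 (min_le_left _ _) ht0 _ h1
    have b2 := scale _ _ _ hmin0 (min_le_right _ _) h0 _ h2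
    push_cast
    linarith

end Certified

/-! ### The mixing phase -/

/-- For a balanced sparse cut there is a seed, of mass a constant fraction of the whole, that
separates vertices with very different distributions. -/
theorem exists_mixing_seed {V : Type*} [Fintype V] [DecidableEq V] {m : V → ℝ} {P : V → V → ℝ}
    (hP : IsTransport m P) (hm : ∀ i, 0 < m i) (hV : 0 < ∑ i, m i) {S : Finset V}
    (h1 : (∑ i, m i) / 4 ≤ ∑ i ∈ S, m i) (h2 : (∑ i, m i) / 4 ≤ ∑ i ∈ Sᶜ, m i)
    (hQ : transportCut m P S ≤ (∑ i, m i) / 32) :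
    ∃ s : V → ℝ, ∑ i, m i * s i = 0 ∧ (∀ i, |s i| ≤ 1) ∧ (∃ i, m i * s i ≠ 0) ∧
      (∑ i, m i) / 4 ≤ ∑ i, m i * |s i| ∧
      ∀ i j, s i * s j < 0 → 1 ≤ ∑ a, |P i a - P j a| := by
  -- The core of `S`: by `sum_filter_ge` its mass is at least `1 / 4 - 4 / 32 = 1 / 8` of the whole.
  -- The same holds on the other side, and the lighter core serves as `u`.
  let g : Finset V → Finset V := fun S => S.filter fun i => ∑ a ∈ Sᶜ, P i a ≤ 1 / 4
  have key : ∀ S : Finset V, (∑ i, m i) / 4 ≤ ∑ i ∈ S, m i → transportCut m P S ≤ (∑ i, m i) / 32 →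
      ∑ i ∈ g S, m i ≤ ∑ i ∈ g Sᶜ, m i → ∃ s : V → ℝ, ∑ i, m i * s i = 0 ∧ (∀ i, |s i| ≤ 1) ∧
      (∃ i, m i * s i ≠ 0) ∧ (∑ i, m i) / 4 ≤ ∑ i, m i * |s i| ∧
      ∀ i j, s i * s j < 0 → 1 ≤ ∑ a, |P i a - P j a| := by
    intro S h1 hQ hle
    have hge := sum_filter_ge hP hm S
    have e : ∀ T : Finset V, ∑ i, m i * (if i ∈ T then 1 else 0) = ∑ i ∈ T, m i := fun T => by
      simp only [mul_ite, mul_one, mul_zero, sum_ite_mem, univ_inter]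
    have ind : ∀ T : Finset V, ∀ i, (0 : ℝ) ≤ (if i ∈ T then 1 else 0) ∧
        (if i ∈ T then (1 : ℝ) else 0) ≤ 1 := fun T i => by split_ifs <;> norm_num
    obtain ⟨c, c0, c1, s1, s2, s3, s4⟩ := seed_of_disjoint hm (ind (g S)) (ind (g Sᶜ))
      (fun i => by
        by_cases h : i ∈ g S
        · right
          have := (mem_filter.1 h).1
          rw [if_neg fun h' => (mem_compl.1 (mem_filter.1 h').1) this]
        · left; rw [if_neg h])
      (by rw [e]; linarith) (by rw [e, e]; exact hle)
    refine ⟨_, s1, s2, s3, by rw [s4, e]; linarith, ?_⟩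
    have mem : ∀ i, 0 < (if i ∈ g S then (1 : ℝ) else 0) - c * (if i ∈ g Sᶜ then 1 else 0) →
        i ∈ g S := by
      intro i h
      by_contra hn
      rw [if_neg hn] at h
      split_ifs at h <;> linarith
    have mem' : ∀ i, (if i ∈ g S then (1 : ℝ) else 0) - c * (if i ∈ g Sᶜ then 1 else 0) < 0 →
        i ∈ g Sᶜ := by
      intro i h
      by_contra hn
      rw [if_neg hn] at h
      split_ifs at h <;> linarith
    have far : ∀ i ∈ g S, ∀ j ∈ g Sᶜ, 1 ≤ ∑ a, |P i a - P j a| := by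
      intro i hi j hj
      have hj' := (mem_filter.1 hj).2
      rw [compl_compl] at hj'
      exact one_le_sum_abs_sub (hP.row_sum i) (hP.row_sum j) S (mem_filter.1 hi).2 hj'
    intro i j hij
    rcases mul_neg_iff.1 hij with ⟨hi, hj⟩ | ⟨hi, hj⟩
    · exact far i (mem i hi) j (mem' j hj)
    · simp only [abs_sub_comm (P i _)]
      exact far j (mem j hj) i (mem' i hi)
  rcases le_total (∑ i ∈ g S, m i) (∑ i ∈ g Sᶜ, m i) with h | h
  · exact key S h1 hQ h
  · exact key Sᶜ h2 (by rwa [transportCut_compl hP]) (by rwa [compl_compl])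

section Phases

variable {n : ℕ} {ε : ℝ} {E : Finset (Finset (Fin n))} {μ : Fin n → ℕ}

/-- An oracle call along a balanced sparse cut increases the entropy. -/
theorem Solvable.mixing_call (hμ : ∀ i, 0 < (μ i : ℝ)) {P : Fin n → Fin n → ℝ}
    (hP : IsTransport (fun i => (μ i : ℝ)) P) (hε : ε < 1) {T m : ℕ} {a : ℝ} {A : Finset (Fin n)}
    {t : ℕ} (ha : 0 < a) {s : Fin n → ℝ} (hs0 : ∑ i, (μ i : ℝ) * s i = 0) (hs1 : ∀ i, |s i| ≤ 1)
    (hs2 : ∃ i, (μ i : ℝ) * s i ≠ 0) (hs3 : (∑ i, (μ i : ℝ)) / 4 ≤ ∑ i, (μ i : ℝ) * |s i|)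
    (hfar : ∀ i j, s i * s j < 0 → 1 ≤ ∑ a, |P i a - P j a|)
    (hnext : ∀ P', IsTransport (fun i => (μ i : ℝ)) P' →
      transportEntropy (fun i => (μ i : ℝ)) P + (1 - ε) * (∑ i, (μ i : ℝ)) / 64
        ≤ transportEntropy (fun i => (μ i : ℝ)) P' →
      ∀ a' A', 0 < a' → Solvable ε (128 * T) m
        (Certified E μ a' A' (t + 1) (transportCut (fun i => (μ i : ℝ)) P'))) :
    Solvable ε (128 * T) (m + 1)
      (Certified E μ a A t (transportCut (fun i => (μ i : ℝ)) P)) := by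
  refine Solvable.certified_call ha (s := s) (fun G hG => ?_) fun r hα G hG hr => ?_
  · rw [MSCFHypergraph.IsSeed, hG.weights]
    exact ⟨hs0, hs1, hs2⟩
  obtain ⟨f1, f2, f3⟩ := hr.normalized hα
  have hfeas := hr.2.1
  have hdem : ∀ i, G.dem r.Y i = ∑ h ∈ E with i ∈ h, r.Y h i := fun i => by
    rw [MSCFHypergraph.dem, hG.edges]
  simp only [hdem, hG.weights] at f1 f2 f3
  obtain ⟨M, M1, M2, M3, M4, M5⟩ := exists_matching_of_hypergraphFlow E r.Y
    (fun h hh => hfeas.sum_eq_zero (hG.edges.symm ▸ hh))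
  set d : Fin n → ℝ := fun i => ∑ h ∈ E with i ∈ h, r.Y h i
  let M' : Fin n → Fin n → ℝ := fun i j => M i j / r.α
  have N1 : ∀ i j, 0 ≤ M' i j := fun i j => div_nonneg (M1 i j) hα.le
  have N2 : ∀ i j, M' i j = M' j i := fun i j => by simp only [M', M2 i j]
  have N3 : ∀ i, ∑ j, M' i j = |d i / r.α| := fun i => by
    simp only [M', ← sum_div, M3, abs_div, abs_of_pos hα, d]
  have N4 : ∀ i, ∑ j, M' i j ≤ μ i := fun i => by
    rw [N3]
    exact (f2 i).trans (mul_le_of_le_one_right (hμ i).le (hs1 i))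
  -- Edges join demands of opposite sign, and a nonzero demand has the sign of the seed.
  have N5 : ∀ i j, M' i j ≠ 0 → 1 ≤ ∑ a, |P i a - P j a| := by
    intro i j hij
    have hM : M i j ≠ 0 := fun h0 => hij (by simp only [M', h0, zero_div])
    have hd : d i * d j < 0 := M4 i j hM
    have spos : ∀ i, d i ≠ 0 → 0 < d i * s i := by
      intro i hi
      have h0 : 0 ≤ d i * s i := by
        have := f1 i
        rw [div_mul_eq_mul_div] at this
        by_contra hneg
        exact absurd this (not_le.2 (div_neg_of_neg_of_pos (not_le.1 hneg) hα))
      refine lt_of_le_of_ne h0 (Ne.symm (mul_ne_zero hi fun hs => ?_))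
      have := f2 i
      rw [hs, abs_zero, mul_zero] at this
      exact hi ((div_eq_zero_iff.1 (abs_nonpos_iff.1 this)).resolve_right hα.ne')
    have p1 := spos i fun h => by simp [h] at hd
    have p2 := spos j fun h => by simp [h] at hd
    refine hfar i j ?_
    have := mul_pos p1 p2
    by_contra hneg
    nlinarith [mul_nonneg_of_nonpos_of_nonpos hd.le (neg_nonpos.2 (not_lt.1 hneg))]
  have N6 : (1 - ε) * (∑ i, (μ i : ℝ)) / 4 ≤ ∑ i, ∑ j, M' i j := by
    simp only [N3]
    have tri : ∑ i, (μ i : ℝ) * |s i| - ∑ i, |d i / r.α| ≤ ∑ i, |(μ i : ℝ) * s i - d i / r.α| := by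
      rw [← sum_sub_distrib]
      refine sum_le_sum fun i _ => ?_
      have := abs_sub_abs_le_abs_sub ((μ i : ℝ) * s i) (d i / r.α)
      rwa [abs_mul, Nat.abs_cast] at this
    have := mul_le_mul_of_nonneg_left hs3 (sub_pos.2 hε).le
    linarith
  have hP' := hP.mixStep hμ N1 N2 N4
  refine ⟨transportCut (fun i => (μ i : ℝ)) (mixStep (fun i => (μ i : ℝ)) M' P), ?_,
    fun a' ha' A' => hnext _ hP' ?_ a' A' ha'⟩
  · intro G' hE hμ' hfeas' S
    have q1 := transportCut_mixStep_le hP hμ N1 N2 S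
    have q2 := hfeas'.sum_min_le S
    rw [hE] at q2
    have q3 := M5 S
    have q4 : ∑ i ∈ S, ∑ j ∈ Sᶜ, M' i j = (∑ i ∈ S, ∑ j ∈ Sᶜ, M i j) / r.α := by
      simp only [M', sum_div]
    rw [q4] at q1
    -- The factor 1/2 of the lazy step absorbs the factor 2 in `IsFeasibleFlow.sum_min_le`.
    calc r.α * (transportCut _ (mixStep _ M' P) S - transportCut _ P S)
        ≤ r.α * ((∑ i ∈ S, ∑ j ∈ Sᶜ, M i j) / r.α / 2) :=
          mul_le_mul_of_nonneg_left (by linarith) hα.le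
      _ = (∑ i ∈ S, ∑ j ∈ Sᶜ, M i j) / 2 := by field_simp
      _ ≤ G'.cut S := by linarith
  · have := transportEntropy_mixStep_ge hP hμ N1 N2 N4 N5
    linarith

/-- Mixing along balanced sparse cuts until there are none left. -/
theorem Solvable.mixing_phase (hn : 0 < n) (hμ : ∀ i, 0 < (μ i : ℝ)) (hε : ε < 1) {T m₂ : ℕ}
    (hnext : ∀ P, IsTransport (fun i => (μ i : ℝ)) P →
      (∀ S : Finset (Fin n), (∑ i, (μ i : ℝ)) / 4 ≤ ∑ i ∈ S, (μ i : ℝ) →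
        (∑ i, (μ i : ℝ)) / 4 ≤ ∑ i ∈ Sᶜ, (μ i : ℝ) →
        (∑ i, (μ i : ℝ)) / 32 < transportCut (fun i => (μ i : ℝ)) P S) →
      ∀ a A t, 0 < a → t + m₂ ≤ T → Solvable ε (128 * T) m₂
        (Certified E μ a A t (transportCut (fun i => (μ i : ℝ)) P))) :
    ∀ (m₁ : ℕ) (P : Fin n → Fin n → ℝ) (a : ℝ) (A : Finset (Fin n)) (t : ℕ),
      IsTransport (fun i => (μ i : ℝ)) P →
      (∑ i, (μ i : ℝ)) * Real.log n < transportEntropy (fun i => (μ i : ℝ)) P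
        + m₁ * ((1 - ε) * (∑ i, (μ i : ℝ)) / 64) →
      0 < a → t + m₁ + m₂ ≤ T → Solvable ε (128 * T) (m₁ + m₂)
        (Certified E μ a A t (transportCut (fun i => (μ i : ℝ)) P)) := by
  have : Nonempty (Fin n) := ⟨⟨0, hn⟩⟩
  intro m₁
  induction m₁ with
  | zero =>
    intro P a A t hP hlt
    -- An exhausted budget would put the entropy above its maximum.
    have := transportEntropy_le hP hμ
    rw [Fintype.card_fin] at this
    simp only [Nat.cast_zero, zero_mul, add_zero] at hlt
    linarith
  | succ m₁ ih =>
    intro P a A t hP hlt ha hT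
    by_cases hS : ∃ S : Finset (Fin n), (∑ i, (μ i : ℝ)) / 4 ≤ ∑ i ∈ S, (μ i : ℝ) ∧
        (∑ i, (μ i : ℝ)) / 4 ≤ ∑ i ∈ Sᶜ, (μ i : ℝ) ∧
        transportCut (fun i => (μ i : ℝ)) P S ≤ (∑ i, (μ i : ℝ)) / 32
    · obtain ⟨S, h1, h2, hQ⟩ := hS
      obtain ⟨s, s0, s1, s2, s3, s4⟩ := exists_mixing_seed hP hμ
        (sum_pos (fun i _ => hμ i) univ_nonempty) h1 h2 hQ
      rw [Nat.add_right_comm]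
      refine Solvable.mixing_call hμ hP hε ha s0 s1 s2 s3 s4 fun P' hP' hgain a' A' ha' =>
        ih P' a' A' (t + 1) hP' ?_ ha' (by omega)
      push_cast at hlt
      linarith
    · push Not at hS
      exact (hnext P hP hS a A t ha (by omega)).mono_calls (by omega)

end Phases

/-! ### The routing phase -/

/-- If `P` has no balanced sparse cuts, `U` is a largest sparse set, and `z` moves at least half
of the mass of `U` out of `U`, then every cut is large for `P` or for `z`. -/
theorem le_max_transportCut {V : Type*} [Fintype V] [DecidableEq V] {m : V → ℝ} {P : V → V → ℝ}
    (hP : IsTransport m P) (hm : ∀ i, 0 < m i)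
    (hbal : ∀ S : Finset V, (∑ i, m i) / 4 ≤ ∑ i ∈ S, m i → (∑ i, m i) / 4 ≤ ∑ i ∈ Sᶜ, m i →
      (∑ i, m i) / 32 < transportCut m P S)
    {U : Finset V} (hU1 : ∑ i ∈ U, m i ≤ (∑ i, m i) / 2)
    (hU2 : transportCut m P U ≤ (∑ i ∈ U, m i) / 16)
    (hU3 : ∀ S : Finset V, ∑ i ∈ S, m i ≤ (∑ i, m i) / 2 →
      transportCut m P S ≤ (∑ i ∈ S, m i) / 16 → ∑ i ∈ S, m i ≤ ∑ i ∈ U, m i)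
    {z : V → ℝ} (hz1 : ∀ i ∈ U, m i / 2 ≤ z i) (hz2 : ∀ i ∉ U, -m i ≤ z i)
    (S : Finset V) (hS : ∑ i ∈ S, m i ≤ ∑ i ∈ Sᶜ, m i) :
    (∑ i ∈ S, m i) / 64 ≤ max (transportCut m P S) (∑ i ∈ S, z i) := by
  have nn : ∀ T : Finset V, 0 ≤ ∑ i ∈ T, m i := fun T => sum_nonneg fun i _ => (hm i).le
  have compl : ∀ T : Finset V, ∑ i ∈ T, m i + ∑ i ∈ Tᶜ, m i = ∑ i, m i :=
    fun T => sum_add_sum_compl T m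
  -- A sparse set with mass between a quarter and a half would be balanced and have cut at most 1/32
  -- of the whole.
  have hUlt : ∑ i ∈ U, m i ≤ (∑ i, m i) / 4 := by
    by_contra hcon
    have := hbal U (by linarith) (by linarith [compl U])
    linarith
  have split : ∑ i ∈ S ∩ U, m i + ∑ i ∈ S \ U, m i = ∑ i ∈ S, m i := sum_inter_add_sum_sdiff S U m
  have union : ∑ i ∈ U ∪ S, m i = ∑ i ∈ U, m i + ∑ i ∈ S \ U, m i := by
    rw [← union_sdiff_self_eq_union, sum_union disjoint_sdiff]
  have hsub := transportCut_union_le hP hm U S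
  have hinter := nn (S ∩ U)
  -- If `S` is far from contained in `U`, a small cut of `S` would make `U ∪ S` either a heavier
  -- sparse set or a balanced sparse one. Otherwise `z` sends at least `3 / 8 - 1 / 4` of the mass
  -- of `S` out.
  rcases le_or_gt ((∑ i ∈ S, m i) / 4) (∑ i ∈ S \ U, m i) with hbig | hsmall
  · refine le_trans ?_ (le_max_left _ _)
    rcases le_or_gt (∑ i ∈ U ∪ S, m i) ((∑ i, m i) / 2) with hhalf | hhalf
    · by_contra hcon
      have h16 : transportCut m P (U ∪ S) ≤ (∑ i ∈ U ∪ S, m i) / 16 := by linarith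
      have := hU3 _ hhalf h16
      have h0 := nn S
      have : ∑ i ∈ S, m i = 0 := by linarith
      have := transportCut_nonneg hP hm S
      linarith
    · have hle : ∑ i ∈ U ∪ S, m i ≤ 3 * (∑ i, m i) / 4 := by linarith [compl S]
      have := hbal (U ∪ S) (by linarith [nn U, nn S]) (by linarith [compl (U ∪ S)])
      linarith [compl S]
  · refine le_trans ?_ (le_max_right _ _)
    rw [← sum_inter_add_sum_sdiff S U z]
    have h1 : ∑ i ∈ S ∩ U, m i / 2 ≤ ∑ i ∈ S ∩ U, z i :=
      sum_le_sum fun i hi => hz1 i (mem_inter.1 hi).2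
    have h2 : ∑ i ∈ S \ U, -m i ≤ ∑ i ∈ S \ U, z i :=
      sum_le_sum fun i hi => hz2 i (mem_sdiff.1 hi).2
    rw [← sum_div] at h1
    rw [sum_neg_distrib] at h2
    linarith [nn S]

section Phases

variable {n : ℕ} {ε : ℝ} {E : Finset (Finset (Fin n))} {μ : Fin n → ℕ}

/-- Routing the mass of a small set `U` out of `U`: every call leaves at most a fraction `ε` of the
rest, where `z` is what has been routed so far. -/
theorem Solvable.routing_phase (hμ : ∀ i, 0 < (μ i : ℝ)) {Q : Finset (Fin n) → ℝ}
    {U : Finset (Fin n)} (hU : ∑ i ∈ U, (μ i : ℝ) ≤ ∑ i ∈ Uᶜ, (μ i : ℝ)) {T : ℕ}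
    (hfinal : ∀ z : Fin n → ℝ, (∀ i ∈ U, (μ i : ℝ) / 2 ≤ z i) → (∀ i ∉ U, -(μ i : ℝ) ≤ z i) →
      ∀ S, ∑ i ∈ S, (μ i : ℝ) ≤ ∑ i ∈ Sᶜ, (μ i : ℝ) →
        (∑ i ∈ S, (μ i : ℝ)) / 64 ≤ max (Q S) (∑ i ∈ S, z i)) :
    ∀ (m : ℕ) (z : Fin n → ℝ) (a : ℝ) (A : Finset (Fin n)) (t : ℕ),
      (∀ i ∈ U, 0 ≤ z i ∧ z i ≤ μ i) → (∀ i ∉ U, -(μ i : ℝ) ≤ z i ∧ z i ≤ 0) → ∑ i, z i = 0 →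
      (∀ i, ε ^ m * ∑ i ∈ U, ((μ i : ℝ) - z i) ≤ (μ i : ℝ) / 2) → 0 < ε → 0 < a → t + m ≤ T →
      Solvable ε (128 * T) m (Certified E μ a A t fun S => max (Q S) (∑ i ∈ S, z i)) := by
  intro m
  induction m with
  | zero =>
    intro z a A t hz1 hz2 hz hR hε ha hT
    refine Solvable.output (A := A) fun G hG => hG.isApprox ha (hfinal z (fun i hi => ?_)
      fun i hi => (hz2 i hi).1) (by omega)
    have h1 := single_le_sum (f := fun i => (μ i : ℝ) - z i)
      (fun i hi => sub_nonneg.2 (hz1 i hi).2) hi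
    have h2 := hR i
    simp only [pow_zero, one_mul] at h1 h2
    linarith
  | succ m ih =>
    intro z a A t hz1 hz2 hz hR hε ha hT
    by_cases hdone : ∑ i ∈ U, ((μ i : ℝ) - z i) ≤ 0
    · refine (ih z a A t hz1 hz2 hz (fun i => ?_) hε ha (by omega)).mono_calls (by omega)
      exact (mul_nonpos_of_nonneg_of_nonpos (pow_nonneg hε.le _) hdone).trans
        (by linarith [hμ i])
    -- `u` is the fraction of weight still to be sent from `U`, and `v` the fraction of capacity
    -- still free outside `U`.
    set u : Fin n → ℝ := fun i => if i ∈ U then ((μ i : ℝ) - z i) / μ i else 0 with hu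
    set v : Fin n → ℝ := fun i => if i ∈ U then 0 else ((μ i : ℝ) + z i) / μ i with hv
    have mu_u : ∀ i, (μ i : ℝ) * u i = if i ∈ U then (μ i : ℝ) - z i else 0 := fun i => by
      simp only [hu]
      split_ifs
      · exact mul_div_cancel₀ _ (hμ i).ne'
      · exact mul_zero _
    have mu_v : ∀ i, (μ i : ℝ) * v i = if i ∈ Uᶜ then (μ i : ℝ) + z i else 0 := fun i => by
      simp only [hv, mem_compl]
      by_cases h : i ∈ U
      · simp [h]
      · simp only [h, if_false, not_false_eq_true, if_true]
        exact mul_div_cancel₀ _ (hμ i).ne'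
    have sum_u : ∑ i, (μ i : ℝ) * u i = ∑ i ∈ U, ((μ i : ℝ) - z i) := by
      simp only [mu_u, sum_ite_mem, univ_inter]
    have sum_v : ∑ i, (μ i : ℝ) * v i = ∑ i ∈ Uᶜ, ((μ i : ℝ) + z i) := by
      simp only [mu_v, sum_ite_mem, univ_inter]
    have hz' := sum_add_sum_compl U z
    rw [hz] at hz'
    obtain ⟨c, c0, c1, s1, s2, s3, s4⟩ := seed_of_disjoint (u := u) (v := v) hμ
      (fun i => by
        simp only [hu]
        split_ifs with h
        · have := hz1 i h
          exact ⟨div_nonneg (by linarith) (hμ i).le, (div_le_one (hμ i)).2 (by linarith)⟩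
        · norm_num)
      (fun i => by
        simp only [hv]
        split_ifs with h
        · norm_num
        · have := hz2 i h
          exact ⟨div_nonneg (by linarith) (hμ i).le, (div_le_one (hμ i)).2 (by linarith)⟩)
      (fun i => by
        by_cases h : i ∈ U
        · right; simp only [hv, h, if_true]
        · left; simp only [hu, h, if_false])
      (by rw [sum_u]; exact not_le.1 hdone)
      (by rw [sum_u, sum_v, sum_sub_distrib, sum_add_distrib]; linarith)
    set s : Fin n → ℝ := fun i => u i - c * v i with hs
    rw [sum_u] at s4
    refine Solvable.certified_call ha (s := s) (fun G hG => ?_) fun r hα G hG hr => ?_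
    · rw [MSCFHypergraph.IsSeed, hG.weights]
      exact ⟨s1, s2, s3⟩
    obtain ⟨f1, f2, f3⟩ := hr.normalized hα
    have hfeas := hr.2.1
    have hdem : ∀ G' : MSCFHypergraph n, G'.E = E → ∀ i, G'.dem r.Y i = G.dem r.Y i :=
      fun G' hE i => by rw [MSCFHypergraph.dem, MSCFHypergraph.dem, hG.edges, hE]
    rw [hG.weights] at f2 f3
    set f : Fin n → ℝ := fun i => G.dem r.Y i / r.α with hf
    have fU : ∀ i ∈ U, 0 ≤ f i ∧ f i ≤ μ i - z i := by
      intro i hi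
      have hsi : (μ i : ℝ) * s i = μ i - z i := by
        have := mu_u i
        rw [if_pos hi] at this
        rw [← this]
        simp only [hs, hv, hi, if_true, mul_zero, sub_zero]
      have hs0 : 0 ≤ s i := by
        by_contra hneg
        have := mul_neg_of_pos_of_neg (hμ i) (not_le.1 hneg)
        linarith [(hz1 i hi).2]
      have h2 := f2 i
      rw [abs_of_nonneg hs0, hsi] at h2
      refine ⟨?_, (le_abs_self _).trans h2⟩
      rcases eq_or_lt_of_le hs0 with h0 | h0
      · rw [← h0, mul_zero] at hsi
        rw [← hsi] at h2
        exact (abs_nonpos_iff.1 h2).ge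
      · exact nonneg_of_mul_nonneg_left (f1 i) h0
    have fUc : ∀ i ∉ U, -(μ i + z i) ≤ f i ∧ f i ≤ 0 := by
      intro i hi
      have hv0 : 0 ≤ (μ i : ℝ) + z i := by linarith [(hz2 i hi).1]
      have hsi : (μ i : ℝ) * s i = -(c * (μ i + z i)) := by
        have := mu_v i
        rw [if_pos (mem_compl.2 hi)] at this
        rw [← this]
        simp only [hs, hu, hi, if_false, zero_sub]
        ring
      have hs0 : s i ≤ 0 := by
        by_contra hneg
        have := mul_pos (hμ i) (not_le.1 hneg)
        linarith [mul_nonneg c0.le hv0]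
      have h2 := f2 i
      rw [abs_of_nonpos hs0, mul_neg, hsi, neg_neg] at h2
      have h3 : c * (μ i + z i) ≤ μ i + z i := mul_le_of_le_one_left hv0 c1
      refine ⟨by linarith [neg_abs_le (f i)], ?_⟩
      rcases eq_or_lt_of_le hs0 with h0 | h0
      · rw [h0, mul_zero] at hsi
        rw [← neg_eq_iff_eq_neg.2 hsi, neg_zero] at h2
        exact (abs_nonpos_iff.1 h2).le
      · by_contra hpos
        exact absurd (f1 i) (not_le.2 (mul_neg_of_pos_of_neg (not_le.1 hpos) h0))
    have fsum : ∑ i, f i = 0 := by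
      rw [← sum_div, hfeas.sum_dem_univ, zero_div]
    -- The routing error sums to zero, so `U` carries at most half of its `ℓ¹` norm; this cancels
    -- the 2 in the mass of the seed.
    have hrest : ∑ i ∈ U, ((μ i : ℝ) - (z i + f i)) ≤ ε * ∑ i ∈ U, ((μ i : ℝ) - z i) := by
      set e : Fin n → ℝ := fun i => (μ i : ℝ) * s i - f i with he
      have eU : ∑ i ∈ U, ((μ i : ℝ) - (z i + f i)) = ∑ i ∈ U, e i := by
        refine sum_congr rfl fun i hi => ?_
        have := mu_u i
        rw [if_pos hi] at this
        simp only [he, hs, hv, hi, if_true, mul_zero, sub_zero, this]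
        ring
      have esum : ∑ i, e i = 0 := by
        rw [sum_sub_distrib, fsum, s1, sub_zero]
      have h1 := sum_add_sum_compl U e
      have h2 := sum_add_sum_compl U fun i => |e i|
      have h3 : ∑ i ∈ U, e i ≤ ∑ i ∈ U, |e i| := sum_le_sum fun i _ => le_abs_self _
      have h4 : -∑ i ∈ Uᶜ, e i ≤ ∑ i ∈ Uᶜ, |e i| := by
        rw [← sum_neg_distrib]
        exact sum_le_sum fun i _ => neg_le_abs _
      have h5 : ∑ i, |e i| ≤ ε * (2 * ∑ i ∈ U, ((μ i : ℝ) - z i)) := by rw [← s4]; exact f3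
      rw [eU]
      linarith
    refine ⟨fun S => max (Q S) (∑ i ∈ S, (z i + f i)), ?_, fun a' ha' A' =>
      ih (fun i => z i + f i) a' A' (t + 1) ?_ ?_ ?_ ?_ hε ha' (by omega)⟩
    · intro G' hE hμ' hfeas' S
      have h1 := hfeas'.sum_dem_le_cut S
      have h2 : ∑ i ∈ S, f i = (∑ i ∈ S, G'.dem r.Y i) / r.α := by
        rw [sum_div]
        exact sum_congr rfl fun i _ => by rw [hdem G' hE i]
      -- Taking a maximum rather than a sum makes the increment at most the newly routed demand or
      -- zero, both paid for by one cut.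
      have h3 : max (Q S) (∑ i ∈ S, (z i + f i)) - max (Q S) (∑ i ∈ S, z i)
          ≤ max 0 (∑ i ∈ S, f i) := by
        rw [sum_add_distrib, sub_le_iff_le_add]
        refine max_le ?_ ?_
        · linarith [le_max_left 0 (∑ i ∈ S, f i), le_max_left (Q S) (∑ i ∈ S, z i)]
        · linarith [le_max_right 0 (∑ i ∈ S, f i), le_max_right (Q S) (∑ i ∈ S, z i)]
      refine (mul_le_mul_of_nonneg_left h3 hα.le).trans ?_
      rw [mul_max_of_nonneg _ _ hα.le, mul_zero, h2, mul_div_cancel₀ _ hα.ne']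
      exact max_le (G'.cut_nonneg S) h1
    · intro i hi
      have := fU i hi
      have := hz1 i hi
      constructor <;> linarith
    · intro i hi
      have := fUc i hi
      have := hz2 i hi
      constructor <;> linarith
    · rw [sum_add_distrib, hz, fsum, add_zero]
    · intro i
      refine le_trans ?_ (hR i)
      rw [pow_succ, mul_assoc]
      exact mul_le_mul_of_nonneg_left hrest (pow_nonneg hε.le _)

/-- Routing starts at `z = 0`, where the maximum is the transport cut itself. The residual is at
most half the total mass, which supplies the 1/2 demanded by `routing_phase`. -/
theorem Solvable.routing_of_no_balanced (hμ : ∀ i, 0 < (μ i : ℝ)) (hε : 0 < ε)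
    {m₂ T : ℕ} (hm₂ : ∀ i, ε ^ m₂ * ∑ i, (μ i : ℝ) ≤ μ i) (P : Fin n → Fin n → ℝ)
    (hP : IsTransport (fun i => (μ i : ℝ)) P)
    (hbal : ∀ S : Finset (Fin n), (∑ i, (μ i : ℝ)) / 4 ≤ ∑ i ∈ S, (μ i : ℝ) →
        (∑ i, (μ i : ℝ)) / 4 ≤ ∑ i ∈ Sᶜ, (μ i : ℝ) →
        (∑ i, (μ i : ℝ)) / 32 < transportCut (fun i => (μ i : ℝ)) P S)
    (a : ℝ) (A : Finset (Fin n)) (t : ℕ) (ha : 0 < a) (hT : t + m₂ ≤ T) :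
    Solvable ε (128 * T) m₂ (Certified E μ a A t (transportCut (fun i => (μ i : ℝ)) P)) := by
  classical
  obtain ⟨U, hU, hmax⟩ := exists_max_image
    (univ.filter fun S : Finset (Fin n) => ∑ i ∈ S, (μ i : ℝ) ≤ (∑ i, (μ i : ℝ)) / 2 ∧
      transportCut (fun i => (μ i : ℝ)) P S ≤ (∑ i ∈ S, (μ i : ℝ)) / 16)
    (fun S => ∑ i ∈ S, (μ i : ℝ))
    ⟨∅, by
      simp only [mem_filter, mem_univ, true_and, sum_empty, transportCut, zero_div, le_refl,
        and_true]
      exact div_nonneg (sum_nonneg fun i _ => (hμ i).le) zero_le_two⟩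
  simp only [mem_filter, mem_univ, true_and] at hU hmax
  have hc := sum_add_sum_compl U fun i => (μ i : ℝ)
  have := Solvable.routing_phase (ε := ε) (E := E) (T := T) hμ
    (Q := transportCut (fun i => (μ i : ℝ)) P) (U := U)
    (by linarith [hU.1])
    (fun z hz1 hz2 S hS => le_max_transportCut hP hμ hbal hU.1 hU.2
      (fun S h1 h2 => hmax S ⟨h1, h2⟩) hz1 hz2 S hS) m₂ 0 a A t
    (fun i _ => ⟨le_rfl, (hμ i).le⟩) (fun i _ => ⟨neg_nonpos.2 (hμ i).le, le_rfl⟩) (by simp)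
    (fun i => by
      simp only [Pi.zero_apply, sub_zero]
      have h1 := hm₂ i
      have h2 := mul_le_mul_of_nonneg_left hU.1 (pow_nonneg hε.le m₂)
      linarith) hε ha hT
  refine this.mono fun G hG => ⟨hG.edges, hG.weights, hG.isCut, hG.ratioCut_le, fun S => ?_⟩
  simp only [Pi.zero_apply, sum_const_zero, max_eq_left (transportCut_nonneg hP hμ S)]
  exact hG.bound S

/-- The complete algorithm: an initial call, the mixing phase, and the routing phase. -/
theorem solvable_of_pow_le (hn : 2 ≤ n) (hμ : ∀ i, 0 < (μ i : ℝ)) (hε : 0 < ε) (hε1 : ε < 1)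
    {m₁ m₂ : ℕ} (hm₁ : Real.log n < m₁ * ((1 - ε) / 64))
    (hm₂ : ∀ i, ε ^ m₂ * ∑ i, (μ i : ℝ) ≤ μ i) :
    Solvable ε (128 * ((m₁ + m₂ : ℕ) : ℝ)) (m₁ + m₂ + 1)
      fun G : MSCFHypergraph n => G.E = E ∧ G.μ = μ := by
  have : Nonempty (Fin n) := ⟨⟨0, by omega⟩⟩
  have hV : 0 < ∑ i, (μ i : ℝ) := sum_pos (fun i _ => hμ i) univ_nonempty
  have hseed : ∃ s : Fin n → ℝ, ∑ i, (μ i : ℝ) * s i = 0 ∧ (∀ i, |s i| ≤ 1) ∧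
      ∃ i, (μ i : ℝ) * s i ≠ 0 := by
    have key : ∀ i j : Fin n, i ≠ j → (μ i : ℝ) ≤ μ j → ∃ s : Fin n → ℝ,
        ∑ i, (μ i : ℝ) * s i = 0 ∧ (∀ i, |s i| ≤ 1) ∧ ∃ i, (μ i : ℝ) * s i ≠ 0 := by
      intro i j hij hle
      have ind : ∀ i j : Fin n, (0 : ℝ) ≤ (if j = i then 1 else 0) ∧
          (if j = i then (1 : ℝ) else 0) ≤ 1 := fun i j => by split_ifs <;> norm_num
      obtain ⟨c, -, -, s1, s2, s3, -⟩ := seed_of_disjoint hμ (ind i) (ind j)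
        (fun l => by
          by_cases h : l = i
          · right; rw [if_neg]; rintro rfl; exact hij h.symm
          · left; rw [if_neg h])
        (by simpa using hμ i) (by simpa using hle)
      exact ⟨_, s1, s2, s3⟩
    let i : Fin n := ⟨0, by omega⟩
    let j : Fin n := ⟨1, by omega⟩
    have hij : i ≠ j := by simp [i, j]
    rcases le_total (μ i : ℝ) (μ j) with h | h
    · exact key i j hij h
    · exact key j i hij.symm h
  obtain ⟨s, s1, s2, s3⟩ := hseed
  refine Solvable.call (by positivity) (s := s) (fun G hG => ?_) fun r hα => ?_
  · rw [MSCFHypergraph.IsSeed, hG.2]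
    exact ⟨s1, s2, s3⟩
  -- The first call only provides a cut and a value `a`: the count starts at 0, and the identity
  -- transport certifies nothing.
  have hmix := Solvable.mixing_phase (E := E) (T := m₁ + m₂) (m₂ := m₂) (by omega) hμ hε1
    (fun P hP hbal a A t ha hT =>
      Solvable.routing_of_no_balanced hμ hε hm₂ P hP hbal a A t ha hT)
    m₁ _ r.α r.A 0 (isTransport_id _) (by
      have h1 := transportEntropy_nonneg (isTransport_id fun i => (μ i : ℝ)) hμ
      have h2 := mul_lt_mul_of_pos_left hm₁ hV
      linarith) hα (by omega)
  refine hmix.mono fun G hG => ⟨hG.1.1, hG.1.2, hG.2.2.1, hG.2.2.2, fun S => ?_⟩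
  rw [transportCut_id]
  simp

end Phases

end CutMatching

/-! ### Choice of constants -/

theorem mainTheorem2 (k : ℕ) :
    ∃ C : ℝ, 0 < C ∧ ∃ alg : RatioCutAlgorithm,
      ∀ (n : ℕ), 2 ≤ n → ∀ (ε : ℝ), 0 < ε → ε < 1 →
        ∀ (G : MSCFHypergraph n), G.PolyBounded k →
          ∀ (O : (Fin n → ℝ) → PrimalDualReply n), IsApproxOracle G ε O →
            G.IsApproxMinRatioCut (C * (Real.log n / (1 - ε)))
                ((alg n G.E G.μ ε).result O) ∧
              (((alg n G.E G.μ ε).calls O : ℕ) : ℝ) ≤ C * (Real.log n ^ 2 / (1 - ε)) := by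
  have main : ∀ (n : ℕ) (E : Finset (Finset (Fin n))) (μ : Fin n → ℕ) (ε : ℝ),
      ∃ p : OracleProcedure n, 2 ≤ n → 0 < ε → ε < 1 → ∀ G : MSCFHypergraph n, G.E = E → G.μ = μ →
        G.PolyBounded k → ∀ O : (Fin n → ℝ) → PrimalDualReply n, IsApproxOracle G ε O →
          G.IsApproxMinRatioCut (128 * (k + 70) * (Real.log n / (1 - ε))) (p.result O) ∧
          ((p.calls O : ℕ) : ℝ) ≤ 128 * (k + 70) * (Real.log n ^ 2 / (1 - ε)) := by
    intro n E μ ε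
    by_cases hex : (2 ≤ n ∧ 0 < ε ∧ ε < 1) ∧ ∃ G : MSCFHypergraph n, G.μ = μ ∧ G.PolyBounded k
    swap
    · exact ⟨.output ∅, fun hn h0 h1 G _ hμ hG => absurd ⟨⟨hn, h0, h1⟩, G, hμ, hG⟩ hex⟩
    obtain ⟨⟨hn, hε, hε1⟩, G₀, hG₀, hV, hpoly⟩ := hex
    have hvol : G₀.vol Finset.univ = ∑ i, (μ i : ℝ) := by rw [MSCFHypergraph.vol, hG₀]
    rw [hvol] at hV
    simp only [hvol, hG₀] at hpoly
    have hn0 : (0 : ℝ) < n := by exact_mod_cast (by omega : 0 < n)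
    have hθ : 0 < 1 - ε := sub_pos.2 hε1
    have hlow : ∀ i, (∑ i, (μ i : ℝ)) / n ^ k ≤ μ i := fun i => by
      have := (le_div_iff₀ hV).1 (hpoly i)
      rwa [one_div_mul_eq_div] at this
    have hμ : ∀ i, 0 < (μ i : ℝ) := fun i => (div_pos hV (pow_pos hn0 k)).trans_le (hlow i)
    set L := Real.log n / (1 - ε) with hL
    have hlog : 1 / 2 ≤ Real.log n := by
      have := Real.log_le_log zero_lt_two (by exact_mod_cast hn : (2 : ℝ) ≤ n)
      linarith [Real.log_two_gt_d9]
    have hlogL : Real.log n ≤ L := le_div_self (by linarith) hθ (by linarith)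
    have hL0 : 0 ≤ L := by linarith
    have hLθ : L * (1 - ε) = Real.log n := div_mul_cancel₀ _ hθ.ne'
    have hm₁ : Real.log n < (⌊64 * L⌋₊ + 1 : ℕ) * ((1 - ε) / 64) := by
      have := mul_lt_mul_of_pos_right (Nat.lt_floor_add_one (64 * L)) hθ
      push_cast
      linarith
    have hm₂ : ∀ i, ε ^ ⌈k * L⌉₊ * ∑ i, (μ i : ℝ) ≤ μ i := by
      intro i
      refine le_trans ?_ (hlow i)
      rw [div_eq_inv_mul]
      refine mul_le_mul_of_nonneg_right ?_ hV.le
      -- Hence `⌈k * L⌉₊` calls shrink the residual by the factor `n ^ k` of the weight bound.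
      have h1 : ε ≤ Real.exp (-(1 - ε)) := by linarith [Real.add_one_le_exp (-(1 - ε))]
      calc ε ^ ⌈k * L⌉₊ ≤ Real.exp (-(1 - ε)) ^ ⌈k * L⌉₊ := pow_le_pow_left₀ hε.le h1 _
        _ = Real.exp (-(⌈k * L⌉₊ * (1 - ε))) := by rw [← Real.exp_nat_mul]; ring_nf
        _ ≤ Real.exp (-(k * Real.log n)) := by
          refine Real.exp_le_exp.2 (neg_le_neg ?_)
          have := mul_le_mul_of_nonneg_right (Nat.le_ceil (k * L)) hθ.le
          rwa [mul_assoc, hLθ] at this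
        _ = ((n : ℝ) ^ k)⁻¹ := by rw [Real.exp_neg, Real.exp_nat_mul, Real.exp_log hn0]
    obtain ⟨p, hp⟩ := solvable_of_pow_le (E := E) hn hμ hε hε1 hm₁ hm₂
    -- The two roundings cost at most 2, which is at most `4 * L` since `L ≥ 1 / 2`.
    have hT : ((⌊64 * L⌋₊ + 1 + ⌈k * L⌉₊ : ℕ) : ℝ) ≤ (k + 68) * L := by
      have h1 := Nat.floor_le (show 0 ≤ 64 * L by linarith)
      have h2 := (Nat.ceil_lt_add_one (show 0 ≤ k * L by positivity)).le
      push_cast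
      linarith
    refine ⟨p, fun _ _ _ G hE hGμ _ O hO => ?_⟩
    obtain ⟨⟨h1, h2⟩, h3⟩ := hp G ⟨hE, hGμ⟩ O hO
    refine ⟨⟨h1, fun S hS => (h2 S hS).trans
      (mul_le_mul_of_nonneg_right ?_ (G.ratioCut_nonneg hS))⟩, ?_⟩
    · linarith
    · have h4 : ((p.calls O : ℕ) : ℝ) ≤ ((⌊64 * L⌋₊ + 1 + ⌈k * L⌉₊ + 1 : ℕ) : ℝ) := Nat.cast_le.2 h3
      rw [Nat.cast_add_one] at h4
      have h5 : Real.log n ^ 2 / (1 - ε) = Real.log n * L := by rw [hL]; ring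
      have h6 : (1 / 2) * L ≤ Real.log n * L := mul_le_mul_of_nonneg_right hlog hL0
      have hk : (0 : ℝ) ≤ k := Nat.cast_nonneg k
      -- The calls are already linear in `L`; the bound `log n ≥ 1 / 2` turns this into the weaker
      -- quadratic form.
      have h7 := mul_le_mul_of_nonneg_left h6 (show 0 ≤ 128 * ((k : ℝ) + 70) by positivity)
      rw [h5]
      have h8 : 0 ≤ k * L := mul_nonneg hk hL0
      linarith
  choose alg halg using main
  exact ⟨128 * (k + 70), by positivity, alg, fun n hn ε h0 h1 G hG O hO =>
    halg n G.E G.μ ε hn h0 h1 G rfl rfl hG O hO⟩
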